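/- **Theorem 3 (MSE reduction).** Let $K\ge 2$, let $\Delta_{K-1}=\{\theta\in\mathbb{R}^K:\ \theta_i\ge 0,\ \sum_i\theta_i=1\}$, and let $\alpha\in(0,\infty)^K$. For $\eta\in(0,\infty)^K$ let $\mathrm{Dir}_\eta$ denote the Dirichlet distribution on $\Delta_{K-1}$ and also its density $\mathrm{Dir}_\eta(\theta)=\frac{1}{B(\eta)}\prod_{i}\theta_i^{\eta_i-1}$, where $B(\eta)=\prod_i\Gamma(\eta_i)/\Gamma(\sum_i\eta_i)$. Let $H:\mathbb{R}^K\to\mathbb{R}\cup\{-\infty\}$ and $\theta^*\in\Delta_{K-1}$ satisfy: * (A1) $H(\theta)<H(\theta^*)$ for all $\theta\in\Delta_{K-1}$ with $\theta\ne\theta^*$. * (A2) $H$ is continuous on $\Delta_{K-1}$ (as a function into $[-\infty,\infty)$), and is real valued and twice continuously differentiable in an open neighborhood of $\theta^*$ in $\mathbb{R}^K$. * (A3) The Karush–Kuhn–Tucker multipliers $\lambda_i\ge 0$ ($i$ with $\theta^*_i=0$), $\mu\in\mathbb{R}$ for which $\nabla H(\theta^*)=-\sum_{i:\theta_i^*=0}\lambda_i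 e_i+\mu\mathbf{1}$ satisfy $\lambda_i>0$ for every $i$ with $\theta^*_i=0$. * (A4) $d^\top\nabla^2H(\theta^*)d<0$ for every $d\in\mathbb{R}^K\setminus\{0\}$ with $\mathbf{1}^\top d=0$ and $d_i=0$ whenever $\theta^*_i=0$. Let $m$ be the number of zero components of $\theta^*$. Fix $\gamma\in(0,1)$, $0<\epsilon<\min_{i:\theta_i^*>0}\theta_i^*$, and a sample size $N\ge1$. Put $\Delta_{K-1}^\epsilon=\{\theta\in\Delta_{K-1}:\ \theta_i\ge\epsilon\text{ whenever }\theta_i^*>0\}$. For real $n>0$ let $I(n)=\mathbb{E}_{\mathrm{Dir}_\alpha}[e^{nH(\theta)}]$ (with $e^{-\infty}=0$), $$\hat p_{\mathrm{MC}}=\frac1N\sum_{i=1}^N e^{nH(\theta^{(i)})},\qquad \theta^{(i)}\stackrel{\mathrm{iid}}{\sim}\mathrm{Dir}_\alpha,$$ $$\hat p_{\mathrm{IS}}^\gamma=\frac1N\sum_{i=1}^N e^{nH(\theta^{(i)})}\,\frac{\mathrm{Dir}_\alpha(\theta^{(i)})}{\mathrm{Dir}_{\alpha+n^\gamma\theta^*}(\theta^{(i)})}\,\mathbf{1}_{\Delta_{K-1}^\epsilon}(\theta^{(i)}),\qquad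 \theta^{(i)}\stackrel{\mathrm{iid}}{\sim}\mathrm{Dir}_{\alpha+n^\gamma\theta^*},$$ and let $\mathrm{MSE}(\hat p)=\mathbb{E}[(\hat p-I(n))^2]$. Then, as $n\to\infty$, $$\frac{\mathrm{MSE}(\hat p_{\mathrm{IS}}^\gamma)}{\mathrm{MSE}(\hat p_{\mathrm{MC}})}=\Theta\!\left(n^{-\gamma\frac{K-1-m}{2}}\;n^{-\gamma\sum_{i:\theta_i^*=0}\alpha_i}\right),$$ that is, the ratio lies between two positive constant multiples of the right-hand side for all sufficiently large $n$. -/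

import Mathlib

open MeasureTheory Filter Asymptotics
open scoped BigOperators Topology

noncomputable section

namespace DirichletIS

/-- The projected simplex in `ℝ^d` (where `d = K - 1`): `y_i ≥ 0` and `∑ y_i ≤ 1`. -/
def projSimplex (d : ℕ) : Set (Fin d → ℝ) :=
  {y | (∀ i, 0 ≤ y i) ∧ ∑ i, y i ≤ 1}

/-- The coordinate map `y ↦ (y_1, …, y_d, 1 - ∑ y_i)` from the projected simplex onto
`stdSimplex ℝ (Fin (d + 1))`. -/
def simplexCoord {d : ℕ} (y : Fin d → ℝ) : Fin (d + 1) → ℝ :=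
  Fin.snoc (α := fun _ => ℝ) y (1 - ∑ i, y i)

/-- The multivariate Beta function `B(α) = ∏ Γ(α_i) / Γ(∑ α_i)`. -/
def multiBeta {d : ℕ} (α : Fin (d + 1) → ℝ) : ℝ :=
  (∏ i, Real.Gamma (α i)) / Real.Gamma (∑ i, α i)

/-- The Dirichlet density `Dir_α(θ) = B(α)⁻¹ ∏ θ_i ^ (α_i - 1)` on the simplex. -/
def dirDensity {d : ℕ} (α θ : Fin (d + 1) → ℝ) : ℝ :=
  (1 / multiBeta α) * ∏ i, θ i ^ (α i - 1)

/-- The Dirichlet distribution with parameter `α` (all `α_i > 0`), as a measure on `ℝ^(d+1)`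
carried by the simplex: in the coordinates of the projected simplex it has Lebesgue density
`y ↦ Dir_α(y_1, …, y_d, 1 - ∑ y_i)`. -/
def dirichlet {d : ℕ} (α : Fin (d + 1) → ℝ) : Measure (Fin (d + 1) → ℝ) :=
  (((volume : Measure (Fin d → ℝ)).restrict (projSimplex d)).withDensity
    (fun y => ENNReal.ofReal (dirDensity α (simplexCoord y)))).map simplexCoord

/-- The real function `e^{n H}` for `H` with values in `ℝ ∪ {-∞}`, with `e^{-∞} = 0`. -/
def expH {d : ℕ} (H : (Fin (d + 1) → ℝ) → EReal) (n : ℝ) (θ : Fin (d + 1) → ℝ) : ℝ :=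
  if H θ = ⊥ then 0 else Real.exp (n * (H θ).toReal)

/-- The estimand `I(n) = E_{Dir_α}[e^{n H(θ)}]`. -/
def estimand {d : ℕ} (α : Fin (d + 1) → ℝ) (H : (Fin (d + 1) → ℝ) → EReal) (n : ℝ) : ℝ :=
  ∫ θ, expH H n θ ∂(dirichlet α)

/-- The indices of the zero components of `θs`; their number is `m`. -/
def zeroSet {d : ℕ} (θs : Fin (d + 1) → ℝ) : Finset (Fin (d + 1)) :=
  Finset.univ.filter (fun i => θs i = 0)

/-- `lam` (only its entries at the zero components of `θs` matter) and `μ` are Karush-Kuhn-Tucker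
multipliers at `θs` for the maximization over the simplex of the function whose real part is `h`:
`∇h(θs) = - ∑_{i : θs_i = 0} lam_i e_i + μ 𝟏` with `lam_i ≥ 0`. -/
def IsKKT {d : ℕ} (h : (Fin (d + 1) → ℝ) → ℝ) (θs lam : Fin (d + 1) → ℝ) (μ : ℝ) : Prop :=
  (∀ i ∈ zeroSet θs, 0 ≤ lam i) ∧
  ∀ j, fderiv ℝ h θs (Pi.single j 1) = -(if j ∈ zeroSet θs then lam j else 0) + μ

/-- The critical cone at `θs`: `𝟏ᵀ v = 0` and `v_i = 0` whenever `θs_i = 0`. -/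
def criticalCone {d : ℕ} (θs : Fin (d + 1) → ℝ) : Set (Fin (d + 1) → ℝ) :=
  {v | ∑ i, v i = 0 ∧ ∀ i ∈ zeroSet θs, v i = 0}

/-- The four standing assumptions on `H : ℝ^(d+1) → ℝ ∪ {-∞}` at the maximizer `θs`. -/
structure Assumptions {d : ℕ} (H : (Fin (d + 1) → ℝ) → EReal) (θs : Fin (d + 1) → ℝ) :
    Prop where
  /-- `H` takes values in `ℝ ∪ {-∞}`. -/
  ne_top : ∀ θ, H θ ≠ ⊤
  mem_simplex : θs ∈ stdSimplex ℝ (Fin (d + 1))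
  /-- Unique maximum: `H` attains its maximum over the simplex only at `θs`. -/
  unique_max : ∀ θ ∈ stdSimplex ℝ (Fin (d + 1)), θ ≠ θs → H θ < H θs
  /-- `H` is continuous on the simplex (as a function into `[-∞, ∞)`). -/
  continuousOn : ContinuousOn H (stdSimplex ℝ (Fin (d + 1)))
  /-- `H` is real valued and twice continuously differentiable near `θs` in the ambient space. -/
  smooth : ∃ U : Set (Fin (d + 1) → ℝ), IsOpen U ∧ θs ∈ U ∧ (∀ θ ∈ U, H θ ≠ ⊥) ∧
    ContDiffOn ℝ 2 (fun θ => (H θ).toReal) U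
  /-- Strict complementarity: the KKT multipliers of the active constraints are positive. (At a
  maximizer the multipliers exist and are unique; neither fact is part of the assumption.) -/
  strict_compl : ∀ (lam : Fin (d + 1) → ℝ) (μ : ℝ),
    IsKKT (fun θ => (H θ).toReal) θs lam μ → ∀ i ∈ zeroSet θs, 0 < lam i
  /-- The Hessian of `H` at `θs` is negative definite on the critical cone. -/
  neg_def : ∀ v ∈ criticalCone θs, v ≠ 0 →
    iteratedFDeriv ℝ 2 (fun θ => (H θ).toReal) θs ![v, v] < 0

/-- The truncated simplex: `θ_i ≥ ε` for every `i` with `θs_i > 0`. -/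
def truncSimplex {d : ℕ} (θs : Fin (d + 1) → ℝ) (ε : ℝ) : Set (Fin (d + 1) → ℝ) :=
  {θ | θ ∈ stdSimplex ℝ (Fin (d + 1)) ∧ ∀ i, 0 < θs i → ε ≤ θ i}

/-- The parameter `α + n^γ θs` of the proposal distribution. -/
def proposalParam {d : ℕ} (α θs : Fin (d + 1) → ℝ) (γ n : ℝ) : Fin (d + 1) → ℝ :=
  fun i => α i + n ^ γ * θs i

/-- The plain Monte Carlo estimator, as a function of the sample `s = (θ^(1), …, θ^(N))`. -/
def mcEstimator {d N : ℕ} (H : (Fin (d + 1) → ℝ) → EReal) (n : ℝ)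
    (s : Fin N → Fin (d + 1) → ℝ) : ℝ :=
  (1 / (N : ℝ)) * ∑ i, expH H n (s i)

/-- The truncated importance sampling estimator, as a function of the sample
`s = (θ^(1), …, θ^(N))`. -/
def isEstimator {d N : ℕ} (α : Fin (d + 1) → ℝ) (H : (Fin (d + 1) → ℝ) → EReal)
    (θs : Fin (d + 1) → ℝ) (γ ε n : ℝ) (s : Fin N → Fin (d + 1) → ℝ) : ℝ :=
  (1 / (N : ℝ)) * ∑ i, expH H n (s i) *
    (dirDensity α (s i) / dirDensity (proposalParam α θs γ n) (s i)) *
    (truncSimplex θs ε).indicator (fun _ => (1 : ℝ)) (s i)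

/-- Mean squared error `E[(est - target)²]` of an estimator computed from `N` independent samples
with common law `ν` (so that the sample has law `ν^{⊗N}`). -/
def mse {d N : ℕ} (ν : Measure (Fin (d + 1) → ℝ)) (est : (Fin N → Fin (d + 1) → ℝ) → ℝ)
    (target : ℝ) : ℝ :=
  ∫ s, (est s - target) ^ 2 ∂(Measure.pi (fun _ : Fin N => ν))

/-- `MSE(p̂_MC)`: samples from `Dir_α`, target `I(n)`. -/
def mseMC {d : ℕ} (N : ℕ) (α : Fin (d + 1) → ℝ) (H : (Fin (d + 1) → ℝ) → EReal) (n : ℝ) : ℝ :=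
  mse (N := N) (dirichlet α) (mcEstimator H n) (estimand α H n)

/-- `MSE(p̂_IS^γ)`: samples from `Dir_{α + n^γ θs}`, target `I(n)`. -/
def mseIS {d : ℕ} (N : ℕ) (α : Fin (d + 1) → ℝ) (H : (Fin (d + 1) → ℝ) → EReal)
    (θs : Fin (d + 1) → ℝ) (γ ε n : ℝ) : ℝ :=
  mse (N := N) (dirichlet (proposalParam α θs γ n)) (isEstimator α H θs γ ε n) (estimand α H n)

end DirichletIS

end

/-! Write `κ = decayExp α θs`, that is `(K-1-m)/2` plus the sum of the `α i` over the zero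
components of `θs`, and let `h` be the maximal value of `H`. Everything is compared with one model
exponent, `gap`, which is linear in the coordinates where `θs` vanishes and quadratic in the others.
A Laplace estimate gives `E_α[exp(-n gap)] ≍ n^(-κ)` (`exists_integral_exp_gap_le`,
`exists_le_integral_exp_gap`).

By the KKT conditions, strict complementarity and the negative Hessian on the critical cone, `h - H`
is at least a multiple of `gap` on the whole simplex and at most a multiple of it near `θs`. Hence
`I(n) ≍ n^(-κ) e^(nh)`. The Monte Carlo error is `(I(2n) - I(n)^2)/N`, of order `n^(-κ) e^(2nh)`,
because `I(n)^2` has the extra factor `n^(-κ)` and `κ > 0`.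

For importance sampling put `t = n^γ`. The likelihood ratio equals `entropyLaplace α θs t * exp(t *
relEntropy θs θ)` (`dirDensity_div`), where the first factor is `E_α[exp(-t relEntropy)]`. Relative
entropy is also comparable to `gap`, so this factor is of order `t^(-κ) = n^(-γκ)`; no asymptotics
of the Beta function is needed. The second moment is this factor times `E_α[e^(2nH) exp(t
relEntropy)]` over the truncated simplex. Since `γ < 1`, the tilt `t relEntropy` is absorbed by half
of the decay of `e^(2nH)`, and the expectation stays of order `n^(-κ) e^(2nh)`. The squared mean and
the squared bias are at most `I(n)^2`, of order `n^(-2κ) e^(2nh)`, which is negligible against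
`n^(-γκ-κ) e^(2nh)`. The quotient of the two errors is of order `n^(-γκ)`. -/

noncomputable section

namespace DirichletIS

/-! ### Integration in the ambient space and on the simplex -/

theorem lintegral_pi_prod {n : ℕ} (f : Fin n → ℝ → ENNReal) (hf : ∀ i, Measurable (f i)) :
    ∫⁻ x : Fin n → ℝ, ∏ i, f i (x i) = ∏ i, ∫⁻ t, f i t := by
  induction n with
  | zero =>
    simp [volume_pi, Measure.pi_empty_univ]
  | succ n ih =>
    have hmp := (volume_preserving_piFinSuccAbove (fun _ : Fin (n + 1) => ℝ) 0).symm
    rw [← hmp.lintegral_comp_emb (MeasurableEquiv.measurableEmbedding _),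
      Fin.prod_univ_succ, ← ih _ (fun i => hf i.succ), Measure.volume_eq_prod]
    have hm : Measurable fun x : Fin n → ℝ => ∏ i : Fin n, f i.succ (x i) :=
      Finset.measurable_fun_prod _ fun i _ => (hf i.succ).comp (measurable_pi_apply i)
    rw [← lintegral_prod_mul (hf 0).aemeasurable hm.aemeasurable]
    refine lintegral_congr fun p => ?_
    rw [Fin.prod_univ_succ]
    rfl

theorem lintegral_pi_last {d : ℕ} (F : (Fin (d + 1) → ℝ) → ENNReal) (hF : Measurable F) :
    ∫⁻ x, F x = ∫⁻ y : Fin d → ℝ, ∫⁻ t : ℝ, F (Fin.snoc (α := fun _ => ℝ) y t) := by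
  have hmp := (volume_preserving_piFinSuccAbove (fun _ : Fin (d + 1) => ℝ) (Fin.last d)).symm
  rw [← hmp.lintegral_comp_emb (MeasurableEquiv.measurableEmbedding _), Measure.volume_eq_prod,
    lintegral_prod_symm]
  · refine lintegral_congr fun y => lintegral_congr fun t => ?_
    congr 1
    exact Fin.insertNth_last (α := fun _ => ℝ) t y
  · exact (hF.comp (MeasurableEquiv.measurable _)).aemeasurable

theorem measurableSet_orthant (n : ℕ) : MeasurableSet {x : Fin n → ℝ | ∀ i, 0 < x i} := by
  have : {x : Fin n → ℝ | ∀ i, 0 < x i} = ⋂ i, {x | 0 < x i} := by ext; simp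
  rw [this]
  exact MeasurableSet.iInter fun i => measurableSet_lt measurable_const (by fun_prop)

theorem sum_snoc {d : ℕ} (y : Fin d → ℝ) (t : ℝ) :
    ∑ i, Fin.snoc (α := fun _ => ℝ) y t i = ∑ i, y i + t := by
  simp [Fin.sum_univ_castSucc]

theorem sum_simplexCoord {d : ℕ} (y : Fin d → ℝ) : ∑ i, simplexCoord y i = 1 := by
  simp [simplexCoord]

theorem measurable_snoc {d : ℕ} {X : Type*} [MeasurableSpace X] {y : X → Fin d → ℝ} {t : X → ℝ}
    (hy : Measurable y) (ht : Measurable t) :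
    Measurable fun p => Fin.snoc (α := fun _ => ℝ) (y p) (t p) := by
  refine measurable_pi_lambda _ fun i => ?_
  refine Fin.lastCases ?_ (fun j => ?_) i
  · simpa using ht
  · simpa using measurable_pi_iff.1 hy j

theorem measurable_simplexCoord {d : ℕ} : Measurable (simplexCoord (d := d)) := by
  unfold simplexCoord
  exact measurable_snoc measurable_id (by fun_prop)

theorem smul_simplexCoord {d : ℕ} (s : ℝ) (y : Fin d → ℝ) :
    s • simplexCoord y = Fin.snoc (α := fun _ => ℝ) (s • y) (s - ∑ i, (s • y) i) := by
  funext i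
  refine Fin.lastCases ?_ (fun j => ?_) i
  · simp [simplexCoord, ← Finset.mul_sum, mul_sub]
  · simp [simplexCoord]

theorem lintegral_smul_pi {d : ℕ} (f : (Fin d → ℝ) → ENNReal) (hf : Measurable f) {s : ℝ}
    (hs : 0 < s) : ∫⁻ y, f y = ENNReal.ofReal (s ^ d) * ∫⁻ y, f (s • y) := by
  have h := Measure.map_addHaar_smul (volume : Measure (Fin d → ℝ)) hs.ne'
  rw [← lintegral_map hf (measurable_const_smul s), h, lintegral_smul_measure, smul_eq_mul,
    ← mul_assoc, ← ENNReal.ofReal_mul (by positivity)]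
  have : s ^ d * |(s ^ Module.finrank ℝ (Fin d → ℝ))⁻¹| = 1 := by
    rw [Module.finrank_fin_fun, abs_of_pos (by positivity)]
    field_simp
  rw [this]; simp

/-- Integration over the half space `0 < ∑ x_i` by slicing along the hyperplanes `∑ x_i = s`. -/
theorem lintegral_eq_lintegral_slices {d : ℕ} (G : (Fin (d + 1) → ℝ) → ENNReal)
    (hG : Measurable G) :
    ∫⁻ x in {x | 0 < ∑ i, x i}, G x =
      ∫⁻ s in Set.Ioi (0 : ℝ), ENNReal.ofReal (s ^ d) * ∫⁻ y, G (s • simplexCoord y) := by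
  have hS : MeasurableSet {x : Fin (d + 1) → ℝ | 0 < ∑ i, x i} :=
    measurableSet_lt measurable_const (by fun_prop)
  have hF : Measurable (Set.indicator {x : Fin (d + 1) → ℝ | 0 < ∑ i, x i} G) := hG.indicator hS
  rw [← lintegral_indicator hS, lintegral_pi_last _ hF, ← lintegral_indicator measurableSet_Ioi]
  -- For fixed `y`, the last coordinate is translated so that the variable becomes the total `s`.
  -- After the swap, scaling `y` by `s` produces the factor `s ^ d`.
  have h1 : ∀ y : Fin d → ℝ,
      ∫⁻ t : ℝ, Set.indicator {x : Fin (d + 1) → ℝ | 0 < ∑ i, x i} G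
        (Fin.snoc (α := fun _ => ℝ) y t) =
      ∫⁻ s : ℝ, Set.indicator {x : Fin (d + 1) → ℝ | 0 < ∑ i, x i} G
        (Fin.snoc (α := fun _ => ℝ) y (s - ∑ i, y i)) := fun y =>
    (lintegral_sub_right_eq_self (fun t => Set.indicator {x : Fin (d + 1) → ℝ | 0 < ∑ i, x i} G
        (Fin.snoc (α := fun _ => ℝ) y t)) _).symm
  simp_rw [h1]
  rw [lintegral_lintegral_swap]
  · refine lintegral_congr fun s => ?_
    by_cases hs : 0 < s
    · rw [Set.indicator_of_mem (Set.mem_Ioi.2 hs), lintegral_smul_pi _ _ hs]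
      · congr 1
        refine lintegral_congr fun y => ?_
        rw [← smul_simplexCoord, Set.indicator_of_mem]
        simp [← Finset.mul_sum, sum_simplexCoord, hs]
      · exact hF.comp (measurable_snoc measurable_id (by fun_prop))
    · rw [Set.indicator_of_notMem (by simpa using hs)]
      rw [← lintegral_zero (μ := (volume : Measure (Fin d → ℝ)))]
      refine lintegral_congr fun y => Set.indicator_of_notMem ?_ _
      simpa [sum_snoc] using hs
  · exact (hF.comp (measurable_snoc measurable_fst (by fun_prop))).aemeasurable

/-- The hyperplane `x i = 0` is null in the ambient space and invariant under scaling, so all its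
slices `∑ x i = s` contribute the same integral up to the factor `s ^ d`; that integral must vanish.
-/
theorem ae_simplexCoord_ne_zero {d : ℕ} (i : Fin (d + 1)) :
    ∀ᵐ y : Fin d → ℝ, simplexCoord y i ≠ 0 := by
  have hN : MeasurableSet {x : Fin (d + 1) → ℝ | x i = 0} :=
    measurableSet_eq_fun (by fun_prop) measurable_const
  have h := lintegral_eq_lintegral_slices (d := d)
    (Set.indicator {x | x i = 0} 1) (measurable_one.indicator hN)
  have h0 : ∫⁻ x in {x | 0 < ∑ i, x i},
      Set.indicator {x : Fin (d + 1) → ℝ | x i = 0} (1 : (Fin (d + 1) → ℝ) → ENNReal) x = 0 := by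
    refine le_antisymm ((setLIntegral_le_lintegral _ _).trans ?_) bot_le
    rw [lintegral_indicator_one hN]
    exact (Measure.pi_hyperplane _ i 0).le
  rw [h0] at h
  have h2 : ∫⁻ y : Fin d → ℝ, Set.indicator {x | x i = 0} (1 : (Fin (d + 1) → ℝ) → ENNReal) (simplexCoord y) = 0 := by
    by_contra hne
    refine hne ?_
    have h3 : ∫⁻ s in Set.Ioi (0 : ℝ), ENNReal.ofReal (s ^ d) *
        ∫⁻ y : Fin d → ℝ, Set.indicator {x | x i = 0} (1 : (Fin (d + 1) → ℝ) → ENNReal) (simplexCoord y) = 0 := by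
      rw [h]
      refine setLIntegral_congr_fun measurableSet_Ioi fun s hs => ?_
      have hs' : s ≠ 0 := ne_of_gt hs
      simp [Set.indicator, hs']
    rw [lintegral_mul_const _ (by fun_prop), mul_eq_zero] at h3
    refine h3.resolve_left fun h4 => ?_
    rw [setLIntegral_eq_zero_iff measurableSet_Ioi (by fun_prop)] at h4
    have h5 : ∀ᵐ s : ℝ, s ∉ Set.Ioi (0 : ℝ) := by
      filter_upwards [h4] with s hs hs0
      have := hs hs0
      rw [ENNReal.ofReal_eq_zero] at this
      exact absurd (pow_pos hs0 d) (not_lt.2 this)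
    have h6 : volume (Set.Ioi (0 : ℝ)) = 0 := by
      have h7 := ae_iff.1 h5
      simpa only [not_not, Set.ofPred_mem_eq] using h7
    simp at h6
  rw [lintegral_eq_zero_iff (by exact (measurable_one.indicator hN).comp measurable_simplexCoord)]
    at h2
  filter_upwards [h2] with y hy h
  simp [Set.indicator, h] at hy

theorem mem_projSimplex_iff {d : ℕ} (y : Fin d → ℝ) :
    y ∈ projSimplex d ↔ ∀ i, 0 ≤ simplexCoord y i := by
  rw [Fin.forall_fin_succ']
  simp [projSimplex, simplexCoord]

theorem ae_mem_projSimplex_iff (d : ℕ) :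
    ∀ᵐ y : Fin d → ℝ, y ∈ projSimplex d ↔ ∀ i, 0 < simplexCoord y i := by
  filter_upwards [ae_all_iff.2 (ae_simplexCoord_ne_zero (d := d))] with y hy
  rw [mem_projSimplex_iff]
  exact forall_congr' fun i => ⟨fun h => lt_of_le_of_ne h (hy i).symm, le_of_lt⟩

theorem measurableSet_projSimplex (d : ℕ) : MeasurableSet (projSimplex d) := by
  have : projSimplex d = {y | ∀ i, 0 ≤ simplexCoord y i} := Set.ext mem_projSimplex_iff
  rw [this]
  have : {y : Fin d → ℝ | ∀ i, 0 ≤ simplexCoord y i} = ⋂ i, {y | 0 ≤ simplexCoord y i} := by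
    ext; simp
  rw [this]
  exact MeasurableSet.iInter fun i => measurableSet_le measurable_const
    ((measurable_pi_apply i).comp measurable_simplexCoord)

theorem simplexCoord_mem {d : ℕ} {y : Fin d → ℝ} (hy : y ∈ projSimplex d) :
    simplexCoord y ∈ stdSimplex ℝ (Fin (d + 1)) :=
  ⟨(mem_projSimplex_iff y).1 hy, sum_simplexCoord y⟩

/-! ### The Dirichlet distribution -/

theorem sum_param_pos {d : ℕ} {α : Fin (d + 1) → ℝ} (hα : ∀ i, 0 < α i) : 0 < ∑ i, α i :=
  Finset.sum_pos (fun i _ => hα i) Finset.univ_nonempty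

theorem multiBeta_pos {d : ℕ} {α : Fin (d + 1) → ℝ} (hα : ∀ i, 0 < α i) : 0 < multiBeta α :=
  div_pos (Finset.prod_pos fun i _ => Real.Gamma_pos_of_pos (hα i))
    (Real.Gamma_pos_of_pos (sum_param_pos hα))

theorem measurable_dirDensity {d : ℕ} (α : Fin (d + 1) → ℝ) : Measurable (dirDensity α) := by
  unfold dirDensity
  fun_prop

theorem dirDensity_nonneg {d : ℕ} {α θ : Fin (d + 1) → ℝ} (hα : ∀ i, 0 < α i)
    (hθ : ∀ i, 0 ≤ θ i) : 0 ≤ dirDensity α θ :=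
  mul_nonneg (one_div_nonneg.2 (multiBeta_pos hα).le)
    (Finset.prod_nonneg fun i _ => Real.rpow_nonneg (hθ i) _)

theorem measurable_dirDensity_simplexCoord {d : ℕ} (α : Fin (d + 1) → ℝ) :
    Measurable fun y : Fin d → ℝ => ENNReal.ofReal (dirDensity α (simplexCoord y)) :=
  ((measurable_dirDensity α).comp measurable_simplexCoord).ennreal_ofReal

theorem lintegral_dirichlet {d : ℕ} (α : Fin (d + 1) → ℝ) (F : (Fin (d + 1) → ℝ) → ENNReal)
    (hF : Measurable F) :
    ∫⁻ θ, F θ ∂dirichlet α = ∫⁻ y in projSimplex d,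
      ENNReal.ofReal (dirDensity α (simplexCoord y)) * F (simplexCoord y) := by
  rw [dirichlet, lintegral_map hF measurable_simplexCoord,
    lintegral_withDensity_eq_lintegral_mul _ (measurable_dirDensity_simplexCoord α)
      (g := fun y => F (simplexCoord y)) (hF.comp measurable_simplexCoord)]
  rfl

/-- The weight is homogeneous of degree `∑ α i - (d + 1)`, so total and direction separate when the
orthant is sliced. This trades an integral on the simplex for one on the orthant, where product
functions integrate coordinatewise; `g` is free, to be chosen as an exponential or as a short window
near `s = 1`. -/
theorem lintegral_weight_mul {d : ℕ} {α : Fin (d + 1) → ℝ} (hα : ∀ i, 0 < α i)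
    (g : ℝ → ENNReal) (hg : Measurable g) (F : (Fin (d + 1) → ℝ) → ENNReal) (hF : Measurable F) :
    ∫⁻ x in {x : Fin (d + 1) → ℝ | ∀ i, 0 < x i},
      ENNReal.ofReal (∏ i, x i ^ (α i - 1)) * (g (∑ i, x i) * F ((∑ i, x i)⁻¹ • x)) =
    (∫⁻ s in Set.Ioi (0 : ℝ), ENNReal.ofReal (s ^ (∑ i, α i - 1)) * g s) *
      (ENNReal.ofReal (multiBeta α) * ∫⁻ θ, F θ ∂dirichlet α) := by
  have hP := measurableSet_orthant (d + 1)
  set G : (Fin (d + 1) → ℝ) → ENNReal := Set.indicator {x | ∀ i, 0 < x i} fun x =>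
    ENNReal.ofReal (∏ i, x i ^ (α i - 1)) * (g (∑ i, x i) * F ((∑ i, x i)⁻¹ • x)) with hGdef
  have hGm : Measurable G := by
    refine Measurable.indicator ?_ hP
    refine Measurable.mul (by fun_prop) (Measurable.mul (hg.comp (by fun_prop)) (hF.comp ?_))
    exact measurable_pi_lambda _ fun i => by simp only [Pi.smul_apply]; fun_prop
  have hsub : ∫⁻ x in {x | 0 < ∑ i, x i}, G x = ∫⁻ x in {x : Fin (d + 1) → ℝ | ∀ i, 0 < x i},
      ENNReal.ofReal (∏ i, x i ^ (α i - 1)) * (g (∑ i, x i) * F ((∑ i, x i)⁻¹ • x)) := by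
    rw [setLIntegral_indicator hP, Set.inter_eq_left.2]
    exact fun x hx => Finset.sum_pos (fun i _ => hx i) Finset.univ_nonempty
  rw [← hsub, lintegral_eq_lintegral_slices G hGm]
  have hB := multiBeta_pos hα
  have hin : ∀ s ∈ Set.Ioi (0 : ℝ), ENNReal.ofReal (s ^ d) * ∫⁻ y, G (s • simplexCoord y) =
      (ENNReal.ofReal (s ^ (∑ i, α i - 1)) * g s) *
        (ENNReal.ofReal (multiBeta α) * ∫⁻ θ, F θ ∂dirichlet α) := by
    intro s hs
    have hs' : 0 < s := hs
    have hpt : ∀ᵐ y : Fin d → ℝ, G (s • simplexCoord y) =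
        Set.indicator (projSimplex d) (fun y =>
          (ENNReal.ofReal (s ^ (∑ i, α i - (d + 1))) * g s * ENNReal.ofReal (multiBeta α)) *
          (ENNReal.ofReal (dirDensity α (simplexCoord y)) * F (simplexCoord y))) y := by
      filter_upwards [ae_mem_projSimplex_iff d] with y hy
      by_cases hmem : y ∈ projSimplex d
      · have hpos := hy.1 hmem
        have h1 : (s • simplexCoord y) ∈ {x : Fin (d + 1) → ℝ | ∀ i, 0 < x i} := fun i => by
          simpa using mul_pos hs' (hpos i)
        rw [hGdef, Set.indicator_of_mem h1, Set.indicator_of_mem hmem]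
        have hsum : ∑ i, (s • simplexCoord y) i = s := by
          simp [← Finset.mul_sum, sum_simplexCoord]
        have hprod : ∏ i, (s • simplexCoord y) i ^ (α i - 1) =
            s ^ (∑ i, α i - (d + 1)) * (multiBeta α * dirDensity α (simplexCoord y)) := by
          rw [dirDensity, ← mul_assoc (multiBeta α), mul_one_div_cancel hB.ne', one_mul]
          simp only [Pi.smul_apply, smul_eq_mul]
          have : ∀ i, (s * simplexCoord y i) ^ (α i - 1) =
              s ^ (α i - 1) * simplexCoord y i ^ (α i - 1) := fun i =>
            Real.mul_rpow hs'.le (hpos i).le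
          simp_rw [this]
          rw [Finset.prod_mul_distrib, ← Real.rpow_sum_of_pos hs']
          simp
        rw [hprod, hsum, smul_smul, inv_mul_cancel₀ hs'.ne', one_smul,
          ENNReal.ofReal_mul (by positivity), ENNReal.ofReal_mul hB.le]
        ring
      · have h1 : (s • simplexCoord y) ∉ {x : Fin (d + 1) → ℝ | ∀ i, 0 < x i} := fun h =>
          hmem (hy.2 fun i => by simpa [hs'] using h i)
        rw [hGdef, Set.indicator_of_notMem h1, Set.indicator_of_notMem hmem]
    have hm : Measurable fun y : Fin d → ℝ =>
        ENNReal.ofReal (dirDensity α (simplexCoord y)) * F (simplexCoord y) :=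
      (measurable_dirDensity_simplexCoord α).mul (hF.comp measurable_simplexCoord)
    rw [lintegral_congr_ae hpt, lintegral_indicator (measurableSet_projSimplex d),
      lintegral_const_mul _ hm, ← lintegral_dirichlet α F hF]
    have : s ^ (∑ i, α i - 1) = s ^ d * s ^ (∑ i, α i - (d + 1)) := by
      rw [← Real.rpow_natCast, ← Real.rpow_add hs']
      congr 1; ring
    rw [this, ENNReal.ofReal_mul (by positivity)]
    ring
  rw [setLIntegral_congr_fun measurableSet_Ioi hin, lintegral_mul_const]
  exact Measurable.mul (by fun_prop) hg

theorem lintegral_rpow_mul_exp_neg {a r : ℝ} (ha : 0 < a) (hr : 0 < r) :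
    ∫⁻ t in Set.Ioi (0 : ℝ), ENNReal.ofReal (t ^ (a - 1) * Real.exp (-(r * t))) =
      ENNReal.ofReal ((1 / r) ^ a * Real.Gamma a) := by
  rw [← Real.integral_rpow_mul_exp_neg_mul_Ioi ha hr, ofReal_integral_eq_lintegral_ofReal]
  -- A non-integrable function would have Bochner integral `0`, whereas the Gamma integral is
  -- positive.
  · by_contra h
    have := Real.integral_rpow_mul_exp_neg_mul_Ioi ha hr
    rw [integral_undef h] at this
    have h2 : 0 < (1 / r) ^ a * Real.Gamma a :=
      mul_pos (by positivity) (Real.Gamma_pos_of_pos ha)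
    linarith
  · filter_upwards [ae_restrict_mem measurableSet_Ioi] with t ht
    have : (0 : ℝ) < t := ht
    positivity

/-- Take `g s = exp (-s)` and `F = 1` in `lintegral_weight_mul`: the orthant integral is a product
of Gamma integrals and the radial factor is `Γ(∑ α i)`, so the total mass is the quotient that
defines `multiBeta`, divided by `multiBeta`. -/
theorem isProbabilityMeasure_dirichlet {d : ℕ} {α : Fin (d + 1) → ℝ} (hα : ∀ i, 0 < α i) :
    IsProbabilityMeasure (dirichlet α) := by
  constructor
  have h := lintegral_weight_mul hα (fun s => ENNReal.ofReal (Real.exp (-(1 * s)))) (by fun_prop)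
    (fun _ => 1) measurable_const
  have hΓ := Real.Gamma_pos_of_pos (sum_param_pos hα)
  have hB := multiBeta_pos hα
  have hR : ∫⁻ s in Set.Ioi (0 : ℝ), ENNReal.ofReal (s ^ (∑ i, α i - 1)) *
      ENNReal.ofReal (Real.exp (-(1 * s))) = ENNReal.ofReal (Real.Gamma (∑ i, α i)) := by
    have := lintegral_rpow_mul_exp_neg (sum_param_pos hα) one_pos
    simp only [one_div_one, Real.one_rpow, one_mul] at this
    rw [← this]
    refine setLIntegral_congr_fun measurableSet_Ioi fun s hs => ?_
    have : (0 : ℝ) < s := hs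
    rw [ENNReal.ofReal_mul (by positivity), one_mul]
  have hL : ∫⁻ x in {x : Fin (d + 1) → ℝ | ∀ i, 0 < x i},
      ENNReal.ofReal (∏ i, x i ^ (α i - 1)) *
        (ENNReal.ofReal (Real.exp (-(1 * ∑ i, x i))) * 1) =
      ENNReal.ofReal (∏ i, Real.Gamma (α i)) := by
    have hP := measurableSet_orthant (d + 1)
    have hprod := lintegral_pi_prod (fun i : Fin (d + 1) => Set.indicator (Set.Ioi 0) fun t =>
      ENNReal.ofReal (t ^ (α i - 1) * Real.exp (-(1 * t))))
      (fun i => Measurable.indicator (by fun_prop) measurableSet_Ioi)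
    rw [ENNReal.ofReal_prod_of_nonneg fun i _ => (Real.Gamma_pos_of_pos (hα i)).le]
    have h1 : ∀ i, ENNReal.ofReal (Real.Gamma (α i)) = ∫⁻ t, Set.indicator (Set.Ioi 0) (fun t =>
      ENNReal.ofReal (t ^ (α i - 1) * Real.exp (-(1 * t)))) t := fun i => by
      rw [lintegral_indicator measurableSet_Ioi, lintegral_rpow_mul_exp_neg (hα i) one_pos]
      simp
    simp_rw [h1]
    rw [← hprod, ← lintegral_indicator hP]
    refine lintegral_congr fun x => ?_
    by_cases hx : ∀ i, 0 < x i
    · rw [Set.indicator_of_mem (by exact hx)]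
      have : ∀ i, Set.indicator (Set.Ioi 0) (fun t =>
          ENNReal.ofReal (t ^ (α i - 1) * Real.exp (-(1 * t)))) (x i) =
          ENNReal.ofReal (x i ^ (α i - 1) * Real.exp (-(1 * x i))) := fun i =>
        Set.indicator_of_mem (Set.mem_Ioi.2 (hx i)) _
      simp_rw [this]
      rw [← ENNReal.ofReal_prod_of_nonneg fun i _ => by have := hx i; positivity,
        Finset.prod_mul_distrib, ← Real.exp_sum, mul_one, ENNReal.ofReal_mul]
      · simp
      · exact Finset.prod_nonneg fun i _ => by have := hx i; positivity
    · rw [Set.indicator_of_notMem (by exact hx)]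
      push Not at hx
      obtain ⟨i, hi⟩ := hx
      exact (Finset.prod_eq_zero (Finset.mem_univ i)
        (Set.indicator_of_notMem (by exact not_lt.2 hi) _)).symm
  rw [hL, hR] at h
  have hprodeq : ∏ i, Real.Gamma (α i) = Real.Gamma (∑ i, α i) * multiBeta α := by
    rw [multiBeta]; field_simp
  rw [hprodeq, ENNReal.ofReal_mul hΓ.le, lintegral_one] at h
  have h2 : ENNReal.ofReal (Real.Gamma (∑ i, α i)) * ENNReal.ofReal (multiBeta α) ≠ 0 := by
    simp [hΓ, hB]
  have h3 : ENNReal.ofReal (Real.Gamma (∑ i, α i)) * ENNReal.ofReal (multiBeta α) ≠ ⊤ :=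
    ENNReal.mul_ne_top ENNReal.ofReal_ne_top ENNReal.ofReal_ne_top
  rw [← mul_assoc] at h
  exact (ENNReal.mul_right_inj h2 h3).1 (by rw [← h, mul_one])

theorem continuous_simplexCoord {d : ℕ} : Continuous (simplexCoord (d := d)) := by
  refine continuous_pi fun i => ?_
  refine Fin.lastCases ?_ (fun j => ?_) i
  · simp only [simplexCoord, Fin.snoc_last]; fun_prop
  · simp only [simplexCoord, Fin.snoc_castSucc]; fun_prop

/-- Being an embedding spares the later integral formulas any measurability hypothesis on the
integrand. -/
theorem measurableEmbedding_simplexCoord {d : ℕ} : MeasurableEmbedding (simplexCoord (d := d)) := by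
  refine continuous_simplexCoord.measurableEmbedding fun y y' h => ?_
  funext j
  simpa [simplexCoord] using congrFun h j.castSucc

theorem integral_dirichlet {d : ℕ} {α : Fin (d + 1) → ℝ} (hα : ∀ i, 0 < α i)
    (f : (Fin (d + 1) → ℝ) → ℝ) :
    ∫ θ, f θ ∂dirichlet α =
      ∫ y in projSimplex d, dirDensity α (simplexCoord y) * f (simplexCoord y) := by
  rw [dirichlet, measurableEmbedding_simplexCoord.integral_map,
    integral_withDensity_eq_integral_toReal_smul (measurable_dirDensity_simplexCoord α)
      (Eventually.of_forall fun _ => ENNReal.ofReal_lt_top)]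
  refine setIntegral_congr_fun (measurableSet_projSimplex d) fun y hy => ?_
  rw [ENNReal.toReal_ofReal (dirDensity_nonneg hα ((mem_projSimplex_iff y).1 hy)), smul_eq_mul]

theorem ae_dirichlet {d : ℕ} (α : Fin (d + 1) → ℝ) :
    ∀ᵐ θ ∂dirichlet α, θ ∈ stdSimplex ℝ (Fin (d + 1)) ∧ ∀ i, 0 < θ i := by
  rw [dirichlet, measurableEmbedding_simplexCoord.ae_map_iff]
  refine (withDensity_absolutelyContinuous _ _).ae_le ?_
  refine (ae_restrict_iff' (measurableSet_projSimplex d)).2 ?_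
  filter_upwards [ae_mem_projSimplex_iff d] with y hy hmem
  exact ⟨simplexCoord_mem hmem, hy.1 hmem⟩

/-- Change of measure between two Dirichlet distributions. -/
theorem integral_dirichlet_change {d : ℕ} {α η : Fin (d + 1) → ℝ} (hα : ∀ i, 0 < α i)
    (hη : ∀ i, 0 < η i) {f g : (Fin (d + 1) → ℝ) → ℝ}
    (h : ∀ θ ∈ stdSimplex ℝ (Fin (d + 1)), (∀ i, 0 < θ i) →
      dirDensity η θ * f θ = dirDensity α θ * g θ) :
    ∫ θ, f θ ∂dirichlet η = ∫ θ, g θ ∂dirichlet α := by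
  rw [integral_dirichlet hη, integral_dirichlet hα]
  refine setIntegral_congr_ae (measurableSet_projSimplex d) ?_
  filter_upwards [ae_mem_projSimplex_iff d] with y hy hmem
  exact h _ (simplexCoord_mem hmem) (hy.1 hmem)

/-! ### Laplace bounds for the model exponent -/

/-- The model exponent in one coordinate: linear at an active constraint, quadratic otherwise. -/
def gapTerm (a x : ℝ) : ℝ := if a = 0 then x else (x - a) ^ 2

/-- The model exponent, comparable to `H θs - H θ` on the simplex. -/
def gap {d : ℕ} (θs θ : Fin (d + 1) → ℝ) : ℝ := ∑ i, gapTerm (θs i) (θ i)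

/-- The decay exponent contributed by one coordinate. -/
def localExp (α a : ℝ) : ℝ := if a = 0 then α else 1 / 2

/-- The decay exponent of `E_{Dir_α}[exp (-n * gap θs θ)]`. -/
def decayExp {d : ℕ} (α θs : Fin (d + 1) → ℝ) : ℝ := ∑ i, localExp (α i) (θs i) - 1 / 2

theorem gapTerm_nonneg {a x : ℝ} (hx : 0 ≤ x) : 0 ≤ gapTerm a x := by
  unfold gapTerm; split_ifs <;> positivity

theorem gap_nonneg {d : ℕ} {θs θ : Fin (d + 1) → ℝ} (hθ : ∀ i, 0 ≤ θ i) : 0 ≤ gap θs θ :=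
  Finset.sum_nonneg fun i _ => gapTerm_nonneg (hθ i)

theorem measurable_gapTerm (a : ℝ) : Measurable (gapTerm a) := by
  unfold gapTerm; split_ifs <;> fun_prop

theorem continuous_gap {d : ℕ} (θs : Fin (d + 1) → ℝ) : Continuous (gap θs) := by
  unfold gap gapTerm
  refine continuous_finsetSum _ fun i _ => ?_
  split_ifs <;> fun_prop

theorem measurable_gap {d : ℕ} (θs : Fin (d + 1) → ℝ) : Measurable (gap θs) :=
  (continuous_gap θs).measurable

theorem lintegral_Ioc_rpow {a b : ℝ} (ha : 0 < a) (hb : 0 ≤ b) :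
    ∫⁻ t in Set.Ioc 0 b, ENNReal.ofReal (t ^ (a - 1)) = ENNReal.ofReal (b ^ a / a) := by
  have hint := (intervalIntegral.intervalIntegrable_rpow' (a := 0) (b := b)
    (r := a - 1) (by linarith)).1
  rw [← ofReal_integral_eq_lintegral_ofReal hint,
    ← intervalIntegral.integral_of_le hb, integral_rpow (Or.inl (by linarith))]
  · simp [Real.zero_rpow ha.ne']
  · filter_upwards [ae_restrict_mem measurableSet_Ioc] with t ht
    exact Real.rpow_nonneg ht.1.le _

theorem lintegral_gaussian {b : ℝ} (hb : 0 < b) (a : ℝ) :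
    ∫⁻ t, ENNReal.ofReal (Real.exp (-(b * (t - a) ^ 2))) = ENNReal.ofReal (√(Real.pi / b)) := by
  rw [lintegral_sub_right_eq_self (fun t => ENNReal.ofReal (Real.exp (-(b * t ^ 2)))) a,
    ← integral_gaussian b]
  simp_rw [← neg_mul]
  rw [ofReal_integral_eq_lintegral_ofReal (integrable_exp_neg_mul_sq hb)]
  exact Eventually.of_forall fun t => (Real.exp_pos _).le

theorem exp_neg_mul_le_rpow {b n : ℝ} (hb : 0 < b) (hn : 1 ≤ n) :
    Real.exp (-(n * b)) ≤ b⁻¹ * n ^ (-(1 / 2) : ℝ) := by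
  have hn0 : 0 < n := by linarith
  have h1 : Real.exp (-(n * b)) ≤ (n * b)⁻¹ := by
    rw [Real.exp_neg]
    exact inv_anti₀ (by positivity) (by linarith [Real.add_one_le_exp (n * b)])
  have h2 : n⁻¹ ≤ n ^ (-(1 / 2) : ℝ) := by
    rw [← Real.rpow_neg_one]
    exact Real.rpow_le_rpow_of_exponent_le hn (by norm_num)
  calc _ ≤ (n * b)⁻¹ := h1
    _ = b⁻¹ * n⁻¹ := by rw [mul_inv, mul_comm]
    _ ≤ _ := by gcongr

theorem rpow_sub_one_le {α a t : ℝ} (hα : 0 < α) (ha : 0 < a) (hat : a ≤ t) (ht : t ≤ 2) :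
    t ^ (α - 1) ≤ 2 ^ α / a := by
  have ht0 : 0 < t := by linarith
  rw [Real.rpow_sub_one ht0.ne']
  gcongr

/-- For `a = 0` this is a Gamma integral. For `a > 0` split at `a / 2`: below, the exponential is at
most `exp(-n a²/32)` while `t ^ (α - 1)` is integrable; above, `t ^ (α - 1)` is bounded by `D` and a
Gaussian integral remains. The factor `1/8` and the range up to `2` are those left by
`gapTerm_normalize` and the window for the total. -/
theorem exists_lintegral_coord_le {α a : ℝ} (hα : 0 < α) (ha : 0 ≤ a) :
    ∃ C > 0, ∀ n : ℝ, 1 ≤ n →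
      ∫⁻ t in Set.Ioc 0 2, ENNReal.ofReal (t ^ (α - 1) * Real.exp (-(n / 8 * gapTerm a t))) ≤
        ENNReal.ofReal (C * n ^ (-localExp α a)) := by
  rcases ha.eq_or_lt with rfl | ha
  · refine ⟨8 ^ α * Real.Gamma α, mul_pos (by positivity) (Real.Gamma_pos_of_pos hα),
      fun n hn => ?_⟩
    have hn0 : 0 < n := by linarith
    simp only [gapTerm, localExp, if_true]
    refine (lintegral_mono_set Set.Ioc_subset_Ioi_self).trans ?_
    rw [lintegral_rpow_mul_exp_neg hα (by positivity)]
    apply le_of_eq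
    congr 1
    rw [one_div_div, Real.div_rpow (by norm_num) hn0.le, Real.rpow_neg hn0.le]
    ring
  · simp only [gapTerm, localExp, if_neg ha.ne']
    set D : ℝ := 2 ^ α / (a / 2)
    refine ⟨2 ^ α / α * (a ^ 2 / 32)⁻¹ + D * √(Real.pi * 8), by positivity, fun n hn => ?_⟩
    have hn0 : 0 < n := by linarith
    have hpt : ∀ t ∈ Set.Ioc (0 : ℝ) 2,
        ENNReal.ofReal (t ^ (α - 1) * Real.exp (-(n / 8 * (t - a) ^ 2))) ≤
        ENNReal.ofReal (t ^ (α - 1)) * ENNReal.ofReal (Real.exp (-(n * (a ^ 2 / 32)))) +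
          ENNReal.ofReal D * ENNReal.ofReal (Real.exp (-(n / 8 * (t - a) ^ 2))) := by
      intro t ht
      have ht0 : 0 < t := ht.1
      rw [← ENNReal.ofReal_mul (by positivity), ← ENNReal.ofReal_mul (by positivity),
        ← ENNReal.ofReal_add (by positivity) (by positivity)]
      apply ENNReal.ofReal_le_ofReal
      rcases le_total t (a / 2) with h | h
      · have : Real.exp (-(n / 8 * (t - a) ^ 2)) ≤ Real.exp (-(n * (a ^ 2 / 32))) := by
          apply Real.exp_le_exp.2
          have : a ^ 2 / 4 ≤ (t - a) ^ 2 := by nlinarith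
          nlinarith
        have h2 : 0 ≤ D * Real.exp (-(n / 8 * (t - a) ^ 2)) := by positivity
        have := mul_le_mul_of_nonneg_left this (Real.rpow_nonneg ht0.le (α - 1))
        linarith
      · have := mul_le_mul_of_nonneg_right (rpow_sub_one_le hα (by positivity) h ht.2)
          (Real.exp_pos (-(n / 8 * (t - a) ^ 2))).le
        have h2 : 0 ≤ t ^ (α - 1) * Real.exp (-(n * (a ^ 2 / 32))) := by positivity
        change _ ≤ D * _ at this
        linarith
    refine (setLIntegral_mono' measurableSet_Ioc hpt).trans ?_
    rw [lintegral_add_left (by fun_prop), lintegral_mul_const _ (by fun_prop),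
      lintegral_const_mul _ (by fun_prop), lintegral_Ioc_rpow hα (by norm_num)]
    have h1 : ∫⁻ t in Set.Ioc (0 : ℝ) 2, ENNReal.ofReal (Real.exp (-(n / 8 * (t - a) ^ 2))) ≤
        ENNReal.ofReal (√(Real.pi / (n / 8))) :=
      (setLIntegral_le_lintegral _ _).trans (lintegral_gaussian (by positivity) a).le
    refine (add_le_add le_rfl (mul_le_mul_right h1 _)).trans ?_
    rw [← ENNReal.ofReal_mul (by positivity), ← ENNReal.ofReal_mul (by positivity),
        ← ENNReal.ofReal_add (by positivity) (by positivity)]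
    apply ENNReal.ofReal_le_ofReal
    have h3 : √(Real.pi / (n / 8)) = √(Real.pi * 8) * n ^ (-(1 / 2) : ℝ) := by
      rw [Real.rpow_neg hn0.le, ← Real.sqrt_eq_rpow, ← Real.sqrt_inv, ← Real.sqrt_mul (by positivity)]
      congr 1; field_simp
    rw [h3, add_mul, mul_assoc (2 ^ α / α), mul_assoc D]
    gcongr
    exact exp_neg_mul_le_rpow (by positivity) hn

/-- Lower endpoint of the box around `θs`. -/
def boxLo (a n : ℝ) : ℝ := if a = 0 then 1 / (2 * n) else a

/-- Upper endpoint of the box around `θs`. -/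
def boxHi (a n : ℝ) : ℝ := if a = 0 then 1 / n else a + n ^ (-(1 / 2) : ℝ)

/-- The bound is the length of the box times the least value of `t ^ (α - 1) = t ^ α / t`, a form
that needs no case split on the sign of `α - 1`. The boxes lie above `θs`, so that the total of a
point in their product is at least `1`, and they are small enough that `n * gapTerm` stays bounded.
-/
theorem exists_le_lintegral_coord {α a : ℝ} (hα : 0 < α) (ha : 0 ≤ a) :
    ∃ c > 0, ∀ n : ℝ, 1 ≤ n → ENNReal.ofReal (c * n ^ (-localExp α a)) ≤
      ∫⁻ t in Set.Icc (boxLo a n) (boxHi a n), ENNReal.ofReal (t ^ (α - 1)) := by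
  have key : ∀ l h m : ℝ, 0 ≤ m → (∀ t ∈ Set.Icc l h, m ≤ t ^ (α - 1)) →
      ENNReal.ofReal (m * (h - l)) ≤ ∫⁻ t in Set.Icc l h, ENNReal.ofReal (t ^ (α - 1)) := by
    intro l h m hm hle
    rw [ENNReal.ofReal_mul hm, ← Real.volume_Icc, ← setLIntegral_const]
    exact setLIntegral_mono' measurableSet_Icc fun t ht => ENNReal.ofReal_le_ofReal (hle t ht)
  rcases ha.eq_or_lt with rfl | ha
  · refine ⟨(1 / 2) ^ α * (1 / 2), by positivity, fun n hn => ?_⟩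
    have hn0 : 0 < n := by linarith
    simp only [localExp, boxLo, boxHi, if_true]
    refine le_trans (le_of_eq ?_) (key _ _ ((1 / (2 * n)) ^ α * n) (by positivity) ?_)
    · congr 1
      have : (1 / (2 * n)) ^ α = (1 / 2) ^ α * n ^ (-α) := by
        rw [Real.rpow_neg hn0.le, ← Real.inv_rpow hn0.le, ← Real.mul_rpow (by norm_num)
          (by positivity)]
        congr 1; field_simp
      rw [this]; field_simp; ring
    · intro t ht
      have ht0 : 0 < t := lt_of_lt_of_le (by positivity) ht.1
      rw [Real.rpow_sub_one ht0.ne', div_eq_mul_inv]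
      have h1 : n ≤ t⁻¹ := by
        rw [le_inv_comm₀ hn0 ht0]; simpa using ht.2
      exact mul_le_mul (Real.rpow_le_rpow (by positivity) ht.1 hα.le) h1 hn0.le (by positivity)
  · refine ⟨a ^ α / (a + 1), by positivity, fun n hn => ?_⟩
    have hn0 : 0 < n := by linarith
    simp only [localExp, boxLo, boxHi, if_neg ha.ne']
    refine le_trans (le_of_eq ?_) (key _ _ (a ^ α / (a + 1)) (by positivity) ?_)
    · congr 1; ring
    · intro t ht
      have ht0 : 0 < t := lt_of_lt_of_le ha ht.1
      have h1 : n ^ (-(1 / 2) : ℝ) ≤ 1 := Real.rpow_le_one_of_one_le_of_nonpos hn (by norm_num)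
      rw [Real.rpow_sub_one ht0.ne']
      have h2 : t ≤ a + 1 := ht.2.trans (by linarith)
      gcongr
      exact ht.1

theorem ofReal_integral_dirichlet {d : ℕ} {α : Fin (d + 1) → ℝ} (hα : ∀ i, 0 < α i)
    {f : (Fin (d + 1) → ℝ) → ℝ} (hf : Measurable f) {C : ℝ}
    (hb : ∀ θ ∈ stdSimplex ℝ (Fin (d + 1)), 0 ≤ f θ ∧ f θ ≤ C) :
    ENNReal.ofReal (∫ θ, f θ ∂dirichlet α) = ∫⁻ θ, ENNReal.ofReal (f θ) ∂dirichlet α := by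
  have := isProbabilityMeasure_dirichlet hα
  refine ofReal_integral_eq_lintegral_ofReal
    (Integrable.of_bound hf.aestronglyMeasurable C ?_) ?_
  · filter_upwards [ae_dirichlet α] with θ hθ
    rw [Real.norm_of_nonneg (hb θ hθ.1).1]
    exact (hb θ hθ.1).2
  · filter_upwards [ae_dirichlet α] with θ hθ using (hb θ hθ.1).1

/-- On the window `1 ≤ s ≤ 2`, so `s ^ (A - 1) = s ^ A / s` lies between `1 / 2` and `2 ^ A`. -/
theorem lintegral_window {A : ℝ} (hA : 0 < A) {δ : ℝ} (hδ : δ ≤ 1) :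
    ENNReal.ofReal (δ / 2) ≤ ∫⁻ s in Set.Ioi (0 : ℝ), ENNReal.ofReal (s ^ (A - 1)) *
        Set.indicator (Set.Icc 1 (1 + δ)) 1 s ∧
      ∫⁻ s in Set.Ioi (0 : ℝ), ENNReal.ofReal (s ^ (A - 1)) *
        Set.indicator (Set.Icc 1 (1 + δ)) 1 s ≤ ENNReal.ofReal (2 ^ A * δ) := by
  have h0 : ∫⁻ s in Set.Ioi (0 : ℝ), ENNReal.ofReal (s ^ (A - 1)) *
      Set.indicator (Set.Icc 1 (1 + δ)) 1 s =
      ∫⁻ s in Set.Icc 1 (1 + δ), ENNReal.ofReal (s ^ (A - 1)) := by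
    have : ∀ s, ENNReal.ofReal (s ^ (A - 1)) * Set.indicator (Set.Icc 1 (1 + δ)) 1 s =
        Set.indicator (Set.Icc 1 (1 + δ)) (fun s => ENNReal.ofReal (s ^ (A - 1))) s := by
      intro s; by_cases h : s ∈ Set.Icc 1 (1 + δ) <;> simp [h]
    simp_rw [this]
    rw [setLIntegral_indicator measurableSet_Icc, Set.inter_eq_left.2]
    exact fun s hs => lt_of_lt_of_le one_pos hs.1
  have hvol : volume (Set.Icc 1 (1 + δ)) = ENNReal.ofReal δ := by
    rw [Real.volume_Icc]; congr 1; ring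
  rw [h0]
  constructor
  · rw [div_eq_inv_mul, ENNReal.ofReal_mul (by norm_num), ← hvol, ← setLIntegral_const]
    refine setLIntegral_mono' measurableSet_Icc fun s hs => ENNReal.ofReal_le_ofReal ?_
    have hs0 : 0 < s := lt_of_lt_of_le one_pos hs.1
    rw [Real.rpow_sub_one hs0.ne', ← one_div]
    exact div_le_div₀ (by positivity) (Real.one_le_rpow hs.1 hA.le) hs0 (by linarith [hs.2])
  · rw [ENNReal.ofReal_mul (by positivity), ← hvol, ← setLIntegral_const]
    refine setLIntegral_mono' measurableSet_Icc fun s hs => ENNReal.ofReal_le_ofReal ?_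
    have hs0 : 0 < s := lt_of_lt_of_le one_pos hs.1
    have := rpow_sub_one_le hA one_pos hs.1 (by linarith [hs.2])
    simpa using this

/-- With `x = s * y`, one has `s y - a = s (y - a) + (s - 1) a`. The second term is at most
`n^(-1/2)`, so squaring costs `2 / n`; the first costs `2 s² ≤ 8`. Division by `8` leaves the error
`1 / 4`. Thus normalizing a point whose total is in the window changes `n * gap` harmlessly. -/
theorem gapTerm_normalize {a x s : ℝ} {n : ℝ} (hn : 1 ≤ n) (ha : 0 ≤ a) (ha1 : a ≤ 1) (hx : 0 < x)
    (hs1 : 1 ≤ s) (hs : s ≤ 1 + n ^ (-(1 / 2) : ℝ)) :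
    n / 8 * gapTerm a x ≤ n * gapTerm a (s⁻¹ * x) + 1 / 4 := by
  have hn0 : 0 < n := by linarith
  set δ := n ^ (-(1 / 2) : ℝ) with hδ
  have hδ2 : n * δ ^ 2 = 1 := by
    rw [hδ, ← Real.rpow_natCast, ← Real.rpow_mul hn0.le]
    norm_num
    rw [Real.rpow_neg_one, mul_inv_cancel₀ hn0.ne']
  have hδ0 : 0 < δ := by positivity
  have hδ1 : δ ≤ 1 := Real.rpow_le_one_of_one_le_of_nonpos hn (by norm_num)
  have hs0 : 0 < s := by linarith
  obtain ⟨y, rfl⟩ : ∃ y, x = s * y := ⟨s⁻¹ * x, by field_simp⟩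
  rw [inv_mul_cancel_left₀ hs0.ne']
  have hy : 0 < y := pos_of_mul_pos_right hx hs0.le
  unfold gapTerm
  split_ifs
  · have : s * y ≤ 2 * y := by gcongr; linarith
    nlinarith
  · have h1 : (s * y - a) ^ 2 ≤ 8 * (y - a) ^ 2 + 2 * δ ^ 2 := by
      have e : s * y - a = s * (y - a) + (s - 1) * a := by ring
      have h2 : (s * (y - a)) ^ 2 ≤ 4 * (y - a) ^ 2 := by
        rw [mul_pow]; gcongr; nlinarith
      have h3 : ((s - 1) * a) ^ 2 ≤ δ ^ 2 := by
        have h4 : (s - 1) * a ≤ δ := by nlinarith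
        have h5 : 0 ≤ (s - 1) * a := mul_nonneg (by linarith) ha
        gcongr
      rw [e]
      nlinarith [sq_nonneg (s * (y - a) - (s - 1) * a)]
    nlinarith

theorem prod_const_mul_rpow {d : ℕ} (C p : Fin (d + 1) → ℝ) {n : ℝ} (hn : 0 < n) :
    ∏ i, C i * n ^ (-p i) = (∏ i, C i) * n ^ (-∑ i, p i) := by
  rw [Finset.prod_mul_distrib, ← Real.rpow_sum_of_pos hn, Finset.sum_neg_distrib]

theorem coord_le_one {d : ℕ} {θ : Fin (d + 1) → ℝ} (hθ : θ ∈ stdSimplex ℝ (Fin (d + 1)))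
    (i : Fin (d + 1)) : θ i ≤ 1 := by
  rw [← hθ.2]
  exact Finset.single_le_sum (fun j _ => hθ.1 j) (Finset.mem_univ i)

/-- Lift to the orthant with the total restricted to `[1, 1 + n^(-1/2)]`. There the integrand is
dominated by a product of one-variable functions, whose integrals decay with exponents `localExp`.
-/
theorem exists_integral_exp_gap_le {d : ℕ} {α θs : Fin (d + 1) → ℝ} (hα : ∀ i, 0 < α i)
    (hθs : θs ∈ stdSimplex ℝ (Fin (d + 1))) :
    ∃ C > 0, ∀ n : ℝ, 1 ≤ n →
      ∫ θ, Real.exp (-(n * gap θs θ)) ∂dirichlet α ≤ C * n ^ (-decayExp α θs) := by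
  choose C hC hCle using fun i => exists_lintegral_coord_le (hα i) (hθs.1 i)
  have hB := multiBeta_pos hα
  set K : ℝ := (d : ℝ) + 1
  set M : ℝ := Real.exp (K / 4) * ∏ i, C i
  have hM : 0 < M := mul_pos (Real.exp_pos _) (Finset.prod_pos fun i _ => hC i)
  refine ⟨2 * M / multiBeta α, by positivity, fun n hn => ?_⟩
  have hn0 : 0 < n := by linarith
  set δ := n ^ (-(1 / 2) : ℝ) with hδ
  have hδ0 : 0 < δ := by positivity
  have hδ1 : δ ≤ 1 := Real.rpow_le_one_of_one_le_of_nonpos hn (by norm_num)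
  have hm : Measurable fun θ => Real.exp (-(n * gap θs θ)) := by
    have := measurable_gap θs
    fun_prop
  have hJ := ofReal_integral_dirichlet hα hm (C := 1) fun θ hθ =>
    ⟨(Real.exp_pos _).le, Real.exp_le_one_iff.2 (by
      have := gap_nonneg (θs := θs) hθ.1
      have := mul_nonneg hn0.le this
      linarith)⟩
  set J := ∫ θ, Real.exp (-(n * gap θs θ)) ∂dirichlet α
  have hJ0 : 0 ≤ J := integral_nonneg fun θ => (Real.exp_pos _).le
  have h := lintegral_weight_mul hα (Set.indicator (Set.Icc 1 (1 + δ)) 1)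
    (measurable_one.indicator measurableSet_Icc)
    (fun θ => ENNReal.ofReal (Real.exp (-(n * gap θs θ)))) hm.ennreal_ofReal
  rw [← hJ] at h
  have hup : ∫⁻ x in {x : Fin (d + 1) → ℝ | ∀ i, 0 < x i},
      ENNReal.ofReal (∏ i, x i ^ (α i - 1)) * (Set.indicator (Set.Icc 1 (1 + δ)) 1 (∑ i, x i) *
        ENNReal.ofReal (Real.exp (-(n * gap θs ((∑ i, x i)⁻¹ • x))))) ≤
      ENNReal.ofReal (M * n ^ (-∑ i, localExp (α i) (θs i))) := by
    have hprod := lintegral_pi_prod (fun i : Fin (d + 1) => Set.indicator (Set.Ioc 0 2) fun t =>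
      ENNReal.ofReal (t ^ (α i - 1) * Real.exp (-(n / 8 * gapTerm (θs i) t))))
      (fun i => Measurable.indicator (by have := measurable_gapTerm (θs i); fun_prop)
        measurableSet_Ioc)
    have hpt : ∀ x ∈ {x : Fin (d + 1) → ℝ | ∀ i, 0 < x i},
        ENNReal.ofReal (∏ i, x i ^ (α i - 1)) * (Set.indicator (Set.Icc 1 (1 + δ)) 1 (∑ i, x i) *
          ENNReal.ofReal (Real.exp (-(n * gap θs ((∑ i, x i)⁻¹ • x))))) ≤
        ENNReal.ofReal (Real.exp (K / 4)) * ∏ i, Set.indicator (Set.Ioc 0 2) (fun t =>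
          ENNReal.ofReal (t ^ (α i - 1) * Real.exp (-(n / 8 * gapTerm (θs i) t)))) (x i) := by
      intro x hx
      have hx' : ∀ i, 0 < x i := hx
      by_cases hs : ∑ i, x i ∈ Set.Icc 1 (1 + δ)
      · have hx2 : ∀ i, x i ∈ Set.Ioc (0 : ℝ) 2 := fun i => ⟨hx' i, by
          have := Finset.single_le_sum (fun j _ => (hx' j).le) (Finset.mem_univ i)
          linarith [hs.2]⟩
        rw [Set.indicator_of_mem hs, Pi.one_apply, one_mul,
          Finset.prod_congr rfl fun i _ => Set.indicator_of_mem (hx2 i) _,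
          ← ENNReal.ofReal_prod_of_nonneg fun i _ => by have := hx' i; positivity,
          Finset.prod_mul_distrib, ← Real.exp_sum,
          ← ENNReal.ofReal_mul (Finset.prod_nonneg fun i _ => Real.rpow_nonneg (hx' i).le _),
          ← ENNReal.ofReal_mul (Real.exp_pos _).le]
        apply ENNReal.ofReal_le_ofReal
        rw [mul_left_comm, ← Real.exp_add]
        refine mul_le_mul_of_nonneg_left (Real.exp_le_exp.2 ?_)
          (Finset.prod_nonneg fun i _ => Real.rpow_nonneg (hx' i).le _)
        have hsum := Finset.sum_le_sum fun i (_ : i ∈ Finset.univ) =>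
          gapTerm_normalize hn (hθs.1 i) (coord_le_one hθs i) (hx' i) hs.1 hs.2
        rw [Finset.sum_add_distrib, ← Finset.mul_sum, ← Finset.mul_sum] at hsum
        simp only [Finset.sum_const, Finset.card_univ, Fintype.card_fin, nsmul_eq_mul] at hsum
        push_cast at hsum
        rw [Finset.sum_neg_distrib, ← Finset.mul_sum]
        simp only [gap, Pi.smul_apply, smul_eq_mul]
        simp only [K]
        linarith
      · simp [Set.indicator_of_notMem hs]
    refine (setLIntegral_mono' (measurableSet_orthant _) hpt).trans
      ((setLIntegral_le_lintegral _ _).trans ?_)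
    rw [lintegral_const_mul' _ _ ENNReal.ofReal_ne_top, hprod]
    have hle : ∏ i, ∫⁻ t, Set.indicator (Set.Ioc 0 2) (fun t =>
        ENNReal.ofReal (t ^ (α i - 1) * Real.exp (-(n / 8 * gapTerm (θs i) t)))) t ≤
        ∏ i, ENNReal.ofReal (C i * n ^ (-localExp (α i) (θs i))) :=
      Finset.prod_le_prod' fun i _ => by
        rw [lintegral_indicator measurableSet_Ioc]; exact hCle i n hn
    refine (mul_le_mul_right hle _).trans (le_of_eq ?_)
    rw [← ENNReal.ofReal_prod_of_nonneg fun i _ => by have := hC i; positivity,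
      prod_const_mul_rpow _ _ hn0, ← ENNReal.ofReal_mul (Real.exp_pos _).le, ← mul_assoc]
  rw [h] at hup
  have hfin := (mul_le_mul_left (lintegral_window (sum_param_pos hα) hδ1).1
    (ENNReal.ofReal (multiBeta α) * ENNReal.ofReal J)).trans hup
  rw [← ENNReal.ofReal_mul hB.le, ← ENNReal.ofReal_mul (by positivity),
    ENNReal.ofReal_le_ofReal_iff (by positivity)] at hfin
  -- The window has mass of order `n^(-1/2)`; dividing it out accounts for the `- 1 / 2` in
  -- `decayExp`.
  have hexp : n ^ (-∑ i, localExp (α i) (θs i)) = δ * n ^ (-decayExp α θs) := by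
    rw [hδ, ← Real.rpow_add hn0, decayExp]; congr 1; ring
  rw [hexp] at hfin
  have h5 : δ * (multiBeta α * J) ≤ δ * (2 * M * n ^ (-decayExp α θs)) := by linarith
  have h6 := le_of_mul_le_mul_left h5 hδ0
  rw [div_mul_eq_mul_div, le_div_iff₀ hB]
  linarith

/-- On the product of the boxes the total lies in `[1, 1 + K τ]` with `τ = n^(-1/2)`, and the
normalized point is within `(K + 1) τ` of `θs`, with active coordinates at most `τ² = 1 / n`. Hence
`n * gap ≤ K (K + 1)²` there, and the volume of the boxes gives the order. The indicator is included
because `H` and the relative entropy are bounded from the required side only near `θs`. -/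
theorem exists_le_integral_exp_gap {d : ℕ} {α θs : Fin (d + 1) → ℝ} (hα : ∀ i, 0 < α i)
    (hθs : θs ∈ stdSimplex ℝ (Fin (d + 1))) {L δ : ℝ} (hL : 0 ≤ L) (hδ : 0 < δ) :
    ∃ c > 0, ∀ᶠ n : ℝ in atTop, c * n ^ (-decayExp α θs) ≤
      ∫ θ, Set.indicator {θ | ∀ i, |θ i - θs i| < δ}
        (fun θ => Real.exp (-(n * (L * gap θs θ)))) θ ∂dirichlet α := by
  choose c hc hcle using fun i => exists_le_lintegral_coord (hα i) (hθs.1 i)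
  have hB := multiBeta_pos hα
  set K : ℝ := (d : ℝ) + 1 with hK
  have hK1 : 1 ≤ K := by simp [hK]
  set M : ℝ := Real.exp (-(L * (K * (K + 1) ^ 2))) * ∏ i, c i
  have hM : 0 < M := mul_pos (Real.exp_pos _) (Finset.prod_pos fun i _ => hc i)
  set A := ∑ i, α i with hA
  refine ⟨M / (2 ^ A * K * multiBeta α), by positivity, ?_⟩
  have htend : Tendsto (fun n : ℝ => n ^ (-(1 / 2) : ℝ)) atTop (𝓝 0) :=
    tendsto_rpow_neg_atTop (by norm_num)
  filter_upwards [eventually_ge_atTop 1, htend.eventually_lt_const (show 0 < δ / (K + 1) by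
    positivity), htend.eventually_lt_const (show 0 < 1 / K by positivity)] with n hn hnδ hnK
  have hn0 : 0 < n := by linarith
  set τ := n ^ (-(1 / 2) : ℝ) with hτ
  have hτ0 : 0 < τ := by positivity
  have hτ2 : n * τ ^ 2 = 1 := by
    rw [hτ, ← Real.rpow_natCast, ← Real.rpow_mul hn0.le]
    norm_num
    rw [Real.rpow_neg_one, mul_inv_cancel₀ hn0.ne']
  have hτK : K * τ ≤ 1 := by
    rw [lt_div_iff₀ (by positivity)] at hnK; linarith
  have hτδ : (K + 1) * τ < δ := by
    rw [lt_div_iff₀ (by positivity)] at hnδ; linarith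
  have hτ1 : τ ≤ 1 := by nlinarith
  have hnτ : 1 / n ≤ τ := by
    have : 1 / n = τ ^ 2 := by field_simp; linarith
    nlinarith
  set V : Set (Fin (d + 1) → ℝ) := {θ | ∀ i, |θ i - θs i| < δ} with hV
  have hVm : MeasurableSet V := by
    have : V = ⋂ i, {θ | |θ i - θs i| < δ} := by ext; simp [hV]
    rw [this]
    exact MeasurableSet.iInter fun i => measurableSet_lt (by fun_prop) measurable_const
  have hm : Measurable (V.indicator fun θ => Real.exp (-(n * (L * gap θs θ)))) := by
    have := measurable_gap θs
    exact Measurable.indicator (by fun_prop) hVm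
  have hJ := ofReal_integral_dirichlet hα hm (C := 1) fun θ hθ => by
    refine ⟨Set.indicator_nonneg (fun θ _ => (Real.exp_pos _).le) θ, ?_⟩
    refine Set.indicator_le' (f := fun θ => Real.exp (-(n * (L * gap θs θ)))) (g := fun θ =>
      max 1 (Real.exp (-(n * (L * gap θs θ))))) (fun _ _ => le_max_right _ _)
      (fun _ _ => zero_le_one.trans (le_max_left _ _)) θ |>.trans ?_
    refine max_le le_rfl (Real.exp_le_one_iff.2 ?_)
    have := gap_nonneg (θs := θs) hθ.1
    have := mul_nonneg hn0.le (mul_nonneg hL this)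
    linarith
  set J := ∫ θ, V.indicator (fun θ => Real.exp (-(n * (L * gap θs θ)))) θ ∂dirichlet α
  have hJ0 : 0 ≤ J := integral_nonneg fun θ => Set.indicator_nonneg (fun θ _ => (Real.exp_pos _).le) θ
  have h := lintegral_weight_mul hα (Set.indicator (Set.Icc 1 (1 + K * τ)) 1)
    (measurable_one.indicator measurableSet_Icc)
    (fun θ => ENNReal.ofReal (V.indicator (fun θ => Real.exp (-(n * (L * gap θs θ)))) θ))
    hm.ennreal_ofReal
  rw [← hJ] at h
  have hlo : ENNReal.ofReal (M * n ^ (-∑ i, localExp (α i) (θs i))) ≤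
      ∫⁻ x in {x : Fin (d + 1) → ℝ | ∀ i, 0 < x i},
      ENNReal.ofReal (∏ i, x i ^ (α i - 1)) *
        (Set.indicator (Set.Icc 1 (1 + K * τ)) 1 (∑ i, x i) *
        ENNReal.ofReal (V.indicator (fun θ => Real.exp (-(n * (L * gap θs θ))))
          ((∑ i, x i)⁻¹ • x))) := by
    have hprod := lintegral_pi_prod (fun i : Fin (d + 1) =>
      Set.indicator (Set.Icc (boxLo (θs i) n) (boxHi (θs i) n)) fun t =>
        ENNReal.ofReal (t ^ (α i - 1)))
      (fun i => Measurable.indicator (by fun_prop) measurableSet_Icc)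
    have hpt : ∀ x : Fin (d + 1) → ℝ,
        ENNReal.ofReal (Real.exp (-(L * (K * (K + 1) ^ 2)))) *
          ∏ i, Set.indicator (Set.Icc (boxLo (θs i) n) (boxHi (θs i) n)) (fun t =>
            ENNReal.ofReal (t ^ (α i - 1))) (x i) ≤
        Set.indicator {x : Fin (d + 1) → ℝ | ∀ i, 0 < x i} (fun x =>
          ENNReal.ofReal (∏ i, x i ^ (α i - 1)) *
          (Set.indicator (Set.Icc 1 (1 + K * τ)) 1 (∑ i, x i) *
          ENNReal.ofReal (V.indicator (fun θ => Real.exp (-(n * (L * gap θs θ))))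
            ((∑ i, x i)⁻¹ • x)))) x := by
      intro x
      by_cases hbox : ∀ i, x i ∈ Set.Icc (boxLo (θs i) n) (boxHi (θs i) n)
      swap
      · push Not at hbox
        obtain ⟨i, hi⟩ := hbox
        rw [Finset.prod_eq_zero (Finset.mem_univ i) (Set.indicator_of_notMem hi _), mul_zero]
        exact zero_le
      have hlo' : ∀ i, θs i ≤ x i ∧ 0 < x i := fun i => by
        have := (hbox i).1
        unfold boxLo at this
        split_ifs at this with h0
        · have h1 : 0 < x i := lt_of_lt_of_le (by positivity) this
          exact ⟨by rw [h0]; exact h1.le, h1⟩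
        · exact ⟨this, lt_of_lt_of_le (lt_of_le_of_ne (hθs.1 i) (Ne.symm h0)) this⟩
      have hhi' : ∀ i, x i ≤ θs i + τ := fun i => by
        have := (hbox i).2
        unfold boxHi at this
        split_ifs at this with h0
        · rw [h0]; linarith
        · exact this
      set s := ∑ i, x i with hs
      have hs1 : 1 ≤ s := by
        rw [← hθs.2]; exact Finset.sum_le_sum fun i _ => (hlo' i).1
      have hs2 : s ≤ 1 + K * τ := by
        calc s ≤ ∑ i, (θs i + τ) := Finset.sum_le_sum fun i _ => hhi' i
          _ = 1 + K * τ := by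
            rw [Finset.sum_add_distrib, hθs.2]; simp [hK]
      have hs0 : 0 < s := by linarith
      have hθ : ∀ i, (s⁻¹ • x) i - θs i ≤ τ ∧ -(K * τ) ≤ (s⁻¹ • x) i - θs i := fun i => by
        simp only [Pi.smul_apply, smul_eq_mul]
        have h1 : s⁻¹ * x i ≤ x i := by
          rw [inv_mul_le_iff₀ hs0]; nlinarith [(hlo' i).2]
        refine ⟨by linarith [hhi' i], ?_⟩
        -- If `θs i ≤ K τ` the left side is nonpositive. Otherwise `(1 + K τ)(θs i - K τ) ≤ θs i ≤ x
        -- i`, because `θs i ≤ 1`.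
        have h2 : (θs i - K * τ) ≤ s⁻¹ * x i := by
          rw [le_inv_mul_iff₀ hs0]
          have := coord_le_one hθs i
          have h3 := hθs.1 i
          have h4 : 0 ≤ K * τ := by positivity
          rcases le_total (θs i) (K * τ) with h5 | h5
          · nlinarith [(hlo' i).2]
          · have : s * (θs i - K * τ) ≤ (1 + K * τ) * (θs i - K * τ) := by gcongr
            nlinarith [(hlo' i).1]
        linarith
      have habs : ∀ i, |(s⁻¹ • x) i - θs i| ≤ (K + 1) * τ := fun i => by
        rw [abs_le]
        constructor <;> nlinarith [(hθ i).1, (hθ i).2, mul_pos (lt_of_lt_of_le one_pos hK1) hτ0]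
      have hVmem : s⁻¹ • x ∈ V := fun i => (habs i).trans_lt hτδ
      rw [Set.indicator_of_mem (by exact fun i => (hlo' i).2),
        Set.indicator_of_mem (show s ∈ Set.Icc 1 (1 + K * τ) from ⟨hs1, hs2⟩),
        Set.indicator_of_mem hVmem, Pi.one_apply, one_mul,
        Finset.prod_congr rfl fun i _ => Set.indicator_of_mem (hbox i) _,
        ← ENNReal.ofReal_prod_of_nonneg fun i _ => Real.rpow_nonneg (hlo' i).2.le _, mul_comm]
      refine mul_le_mul_right (ENNReal.ofReal_le_ofReal (Real.exp_le_exp.2 (neg_le_neg ?_))) _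
      have hgap : gap θs (s⁻¹ • x) ≤ K * ((K + 1) ^ 2 * τ ^ 2) := by
        have : ∀ i ∈ Finset.univ, gapTerm (θs i) ((s⁻¹ • x) i) ≤ (K + 1) ^ 2 * τ ^ 2 := by
          intro i _
          unfold gapTerm
          split_ifs with h0
          · have := (hbox i).2
            rw [boxHi, if_pos h0] at this
            have h1 : s⁻¹ * x i ≤ x i := by
              rw [inv_mul_le_iff₀ hs0]; nlinarith [(hlo' i).2]
            have h2 : 1 / n = τ ^ 2 := by field_simp; linarith
            simp only [Pi.smul_apply, smul_eq_mul]
            nlinarith [sq_nonneg τ]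
          · rw [← mul_pow]
            exact sq_le_sq' (by linarith [(abs_le.1 (habs i)).1]) (abs_le.1 (habs i)).2
        refine (Finset.sum_le_card_nsmul _ _ _ this).trans (le_of_eq ?_)
        simp [hK]
      calc n * (L * gap θs (s⁻¹ • x)) ≤ n * (L * (K * ((K + 1) ^ 2 * τ ^ 2))) := by gcongr
        _ = L * (K * (K + 1) ^ 2) * (n * τ ^ 2) := by ring
        _ = _ := by rw [hτ2, mul_one]
    rw [← lintegral_indicator (measurableSet_orthant _)]
    refine le_trans ?_ (lintegral_mono hpt)
    rw [lintegral_const_mul' _ _ ENNReal.ofReal_ne_top, hprod]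
    have hle : ∏ i, ENNReal.ofReal (c i * n ^ (-localExp (α i) (θs i))) ≤ ∏ i, ∫⁻ t,
        Set.indicator (Set.Icc (boxLo (θs i) n) (boxHi (θs i) n)) (fun t =>
          ENNReal.ofReal (t ^ (α i - 1))) t :=
      Finset.prod_le_prod' fun i _ => by
        rw [lintegral_indicator measurableSet_Icc]; exact hcle i n hn
    refine le_trans (le_of_eq ?_) (mul_le_mul_right hle _)
    rw [← ENNReal.ofReal_prod_of_nonneg fun i _ => by have := hc i; positivity,
      prod_const_mul_rpow _ _ hn0, ← ENNReal.ofReal_mul (Real.exp_pos _).le, ← mul_assoc]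
  rw [h] at hlo
  have hfin := hlo.trans (mul_le_mul_left (lintegral_window (sum_param_pos hα) hτK).2 (ENNReal.ofReal (multiBeta α) * ENNReal.ofReal J))
  rw [← ENNReal.ofReal_mul hB.le, ← ENNReal.ofReal_mul (by positivity),
    ENNReal.ofReal_le_ofReal_iff (by positivity)] at hfin
  have hexp : n ^ (-∑ i, localExp (α i) (θs i)) = τ * n ^ (-decayExp α θs) := by
    rw [hτ, ← Real.rpow_add hn0, decayExp]; congr 1; ring
  rw [hexp] at hfin
  have h5 : τ * (M * n ^ (-decayExp α θs)) ≤ τ * (2 ^ A * K * multiBeta α * J) := by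
    rw [← hA] at hfin; linarith
  have h6 := le_of_mul_le_mul_left h5 hτ0
  rw [div_mul_eq_mul_div, div_le_iff₀ (by positivity)]
  linarith

/-! ### Second order conditions at the maximizer -/

/-- Mean value inequality on `[0, 1]` for `f (x + t v)` minus its second order Taylor polynomial in
`t`; the derivative is small because `fderiv ℝ f` is itself differentiable at `x`. -/
theorem taylor_second_order {E : Type*} [NormedAddCommGroup E] [NormedSpace ℝ E] {f : E → ℝ}
    {x : E} (hf : ContDiffAt ℝ 2 f x) {ε : ℝ} (hε : 0 < ε) :
    ∀ᶠ y in 𝓝 x, |f y - f x - fderiv ℝ f x (y - x) -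
      fderiv ℝ (fderiv ℝ f) x (y - x) (y - x) / 2| ≤ ε * ‖y - x‖ ^ 2 := by
  have hD2 : HasFDerivAt (fderiv ℝ f) (fderiv ℝ (fderiv ℝ f) x) x :=
    ((hf.fderiv_right (m := 1) (by norm_num)).differentiableAt (by norm_num)).hasFDerivAt
  have hdiff : ∀ᶠ y in 𝓝 x, DifferentiableAt ℝ f y := by
    filter_upwards [hf.eventually (by simp)] with y hy using hy.differentiableAt (by norm_num)
  have hlittle := (hasFDerivAt_iff_isLittleO.1 hD2).def hε
  obtain ⟨r, hr, hball⟩ := Metric.eventually_nhds_iff_ball.1 (hdiff.and hlittle)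
  filter_upwards [Metric.ball_mem_nhds x hr] with y hy
  set v := y - x with hv
  set D := fderiv ℝ f x
  set D2 := fderiv ℝ (fderiv ℝ f) x
  have hmem : ∀ t ∈ Set.Icc (0 : ℝ) 1, x + t • v ∈ Metric.ball x r := by
    intro t ht
    rw [mem_ball_iff_norm, add_sub_cancel_left, norm_smul, Real.norm_of_nonneg ht.1]
    rw [mem_ball_iff_norm] at hy
    exact (mul_le_of_le_one_left (norm_nonneg _) ht.2).trans_lt hy
  have hder : ∀ t ∈ Set.Icc (0 : ℝ) 1, HasDerivWithinAt
      (fun t : ℝ => f (x + t • v) - t * D v - t ^ 2 / 2 * D2 v v)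
      (fderiv ℝ f (x + t • v) v - D v - t * D2 v v) (Set.Icc 0 1) t := by
    intro t ht
    have h1 : HasDerivAt (fun t : ℝ => x + t • v) v t := by
      simpa using ((hasDerivAt_id t).smul_const v).const_add x
    have h2 : HasDerivAt (fun t : ℝ => f (x + t • v)) (fderiv ℝ f (x + t • v) v) t :=
      (hball _ (hmem t ht)).1.hasFDerivAt.comp_hasDerivAt t h1
    have h3 : HasDerivAt (fun t : ℝ => t * D v) (D v) t := by
      simpa using (hasDerivAt_id t).mul_const (D v)
    have h4 : HasDerivAt (fun t : ℝ => t ^ 2 / 2 * D2 v v) (t * D2 v v) t := by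
      have := ((hasDerivAt_pow 2 t).div_const 2).mul_const (D2 v v)
      refine this.congr_deriv ?_
      norm_num
    exact ((h2.sub h3).sub h4).hasDerivWithinAt
  have hbound : ∀ t ∈ Set.Ico (0 : ℝ) 1,
      ‖fderiv ℝ f (x + t • v) v - D v - t * D2 v v‖ ≤ ε * ‖v‖ ^ 2 := by
    intro t ht
    have ht' : t ∈ Set.Icc (0 : ℝ) 1 := ⟨ht.1, ht.2.le⟩
    have h1 := (hball _ (hmem t ht')).2
    rw [add_sub_cancel_left] at h1
    have e : fderiv ℝ f (x + t • v) v - D v - t * D2 v v =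
        (fderiv ℝ f (x + t • v) - D - D2 (t • v)) v := by
      simp
    rw [e]
    refine (ContinuousLinearMap.le_opNorm _ _).trans ?_
    have h2 : ‖t • v‖ ≤ ‖v‖ := by
      rw [norm_smul, Real.norm_of_nonneg ht.1]
      exact mul_le_of_le_one_left (norm_nonneg _) ht.2.le
    calc _ ≤ (ε * ‖t • v‖) * ‖v‖ := by gcongr
      _ ≤ (ε * ‖v‖) * ‖v‖ := by gcongr
      _ = _ := by ring
  have := norm_image_sub_le_of_norm_deriv_le_segment_01' hder hbound
  rw [Real.norm_eq_abs] at this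
  convert this using 2
  simp [hv]
  ring

/-- Moving mass from a coordinate `j` with `θs j > 0` to any `i` is feasible, so the `i`-th partial
derivative is at most the `j`-th. The partials therefore agree on the support of `θs`; their common
value is `μ`, and the deficits elsewhere are the multipliers. -/
theorem exists_isKKT {d : ℕ} {h : (Fin (d + 1) → ℝ) → ℝ} {θs : Fin (d + 1) → ℝ}
    (hθs : θs ∈ stdSimplex ℝ (Fin (d + 1))) (hd : DifferentiableAt ℝ h θs)
    (hmax : IsLocalMaxOn h (stdSimplex ℝ (Fin (d + 1))) θs) :
    ∃ (lam : Fin (d + 1) → ℝ) (μ : ℝ), IsKKT h θs lam μ := by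
  have key : ∀ i j, θs j ≠ 0 →
      fderiv ℝ h θs (Pi.single i 1) ≤ fderiv ℝ h θs (Pi.single j 1) := by
    intro i j hj
    rcases eq_or_ne i j with rfl | hij
    · exact le_rfl
    have hj0 : 0 < θs j := lt_of_le_of_ne (hθs.1 j) (Ne.symm hj)
    set y : Fin (d + 1) → ℝ := θs j • (Pi.single i 1 - Pi.single j 1)
    have hmem : θs + y ∈ stdSimplex ℝ (Fin (d + 1)) := by
      constructor
      · intro k
        have := hθs.1 k
        rcases eq_or_ne k i with rfl | hki
        · simp [y, hij]; linarith
        · rcases eq_or_ne k j with rfl | hkj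
          · simp [y, hki]
          · simp [y, hki, hkj, this]
      · simp [y, Finset.sum_add_distrib, hθs.2, ← Finset.mul_sum, Finset.sum_sub_distrib]
    have hy := mem_posTangentConeAt_of_segment_subset
      ((convex_stdSimplex ℝ (Fin (d + 1))).segment_subset hθs hmem)
    have := hmax.hasFDerivWithinAt_nonpos hd.hasFDerivAt.hasFDerivWithinAt hy
    simp only [y, map_smul, map_sub, smul_eq_mul] at this
    by_contra hlt
    push Not at hlt
    have := mul_pos hj0 (sub_pos.2 hlt)
    linarith
  obtain ⟨j, hj⟩ : ∃ j, θs j ≠ 0 := by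
    by_contra hall
    push Not at hall
    have := hθs.2
    simp [hall] at this
  refine ⟨fun i => fderiv ℝ h θs (Pi.single j 1) - fderiv ℝ h θs (Pi.single i 1),
    fderiv ℝ h θs (Pi.single j 1), fun i _ => sub_nonneg.2 (key i j hj), fun i => ?_⟩
  split_ifs with hi
  · ring
  · have hi' : θs i ≠ 0 := by simpa [zeroSet] using hi
    rw [neg_zero, zero_add]
    exact le_antisymm (key i j hj) (key j i hi')

theorem IsKKT.fderiv_apply {d : ℕ} {h : (Fin (d + 1) → ℝ) → ℝ} {θs lam : Fin (d + 1) → ℝ} {μ : ℝ}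
    (hk : IsKKT h θs lam μ) {v : Fin (d + 1) → ℝ} (hv : ∑ i, v i = 0) :
    fderiv ℝ h θs v = -∑ i ∈ zeroSet θs, lam i * v i := by
  have hv' : v = ∑ i, v i • (Pi.single i (1 : ℝ) : Fin (d + 1) → ℝ) := by
    funext k
    simp [Finset.sum_apply, Pi.single_apply]
  conv_lhs => rw [hv']
  rw [map_sum]
  simp only [map_smul, smul_eq_mul, hk.2, mul_add, Finset.sum_add_distrib, ← Finset.sum_mul, hv]
  rw [zero_mul, add_zero, ← Finset.sum_neg_distrib, ← Finset.sum_subset (Finset.subset_univ (zeroSet θs))]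
  · exact Finset.sum_congr rfl fun i hi => by rw [if_pos hi]; ring
  · intro i _ hi
    simp [hi]

/-- The open sets `f < -1/(k+1) + k p` increase with `k` and cover `S`, so by compactness one of
them contains it. -/
theorem exists_le_neg_add_mul {X : Type*} [TopologicalSpace X] {S : Set X} (hS : IsCompact S)
    {f p : X → ℝ} (hf : Continuous f) (hp : Continuous p) (hp0 : ∀ v, 0 ≤ p v)
    (hneg : ∀ v ∈ S, p v = 0 → f v < 0) :
    ∃ c > 0, ∃ M ≥ 0, ∀ v ∈ S, f v ≤ -c + M * p v := by
  have hmono : ∀ {k l : ℕ}, k ≤ l → 1 / ((l : ℝ) + 1) ≤ 1 / ((k : ℝ) + 1) := fun h => by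
    have : (_ : ℝ) ≤ _ := Nat.cast_le.2 h
    gcongr
  obtain ⟨k, hk⟩ := hS.elim_directed_cover
    (fun k : ℕ => {v | f v < -(1 / ((k : ℝ) + 1)) + k * p v})
    (fun k => isOpen_lt hf (by fun_prop)) (fun v hv => by
      rw [Set.mem_iUnion]
      rcases (hp0 v).eq_or_lt with h0 | h0
      · obtain ⟨k, hk⟩ := exists_nat_one_div_lt (neg_pos.2 (hneg v hv h0.symm))
        exact ⟨k, by simp only [Set.mem_ofPred_eq]; rw [← h0]; linarith⟩
      · obtain ⟨k, hk⟩ := exists_nat_gt ((f v + 1) / p v)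
        refine ⟨k, ?_⟩
        rw [div_lt_iff₀ h0] at hk
        have := hmono (Nat.zero_le k)
        simp only [Set.mem_ofPred_eq]
        norm_num at this ⊢
        linarith)
    (directed_of_isDirected_le fun k l hkl v hv => by
      simp only [Set.mem_ofPred_eq] at hv ⊢
      have h1 := hmono hkl
      have h2 : (k : ℝ) * p v ≤ l * p v :=
        mul_le_mul_of_nonneg_right (Nat.cast_le.2 hkl) (hp0 v)
      linarith)
  exact ⟨1 / ((k : ℝ) + 1), by positivity, k, by positivity, fun v hv => (hk hv).le⟩

/-- Use `exists_le_neg_add_mul` on the unit sphere of the hyperplane, where the penalty vanishes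
only on the critical cone, then rescale; the penalty has degree one, whence the factor `‖v‖`. -/
theorem exists_quadratic_bound {d : ℕ} (θs : Fin (d + 1) → ℝ)
    (Q : (Fin (d + 1) → ℝ) →L[ℝ] (Fin (d + 1) → ℝ) →L[ℝ] ℝ)
    (hQ : ∀ v ∈ criticalCone θs, v ≠ 0 → Q v v < 0) :
    ∃ c > 0, ∃ M ≥ 0, ∀ v : Fin (d + 1) → ℝ, ∑ i, v i = 0 →
      Q v v ≤ -c * ‖v‖ ^ 2 + M * (‖v‖ * ∑ i ∈ zeroSet θs, |v i|) := by
  have hS : IsCompact (Metric.sphere (0 : Fin (d + 1) → ℝ) 1 ∩ {v | ∑ i, v i = 0}) :=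
    (isCompact_sphere _ _).inter_right (isClosed_eq (by fun_prop) continuous_const)
  obtain ⟨c, hc, M, hM, hle⟩ := exists_le_neg_add_mul hS (f := fun v => Q v v)
    (p := fun v => ∑ i ∈ zeroSet θs, |v i|) (by fun_prop) (by fun_prop)
    (fun v => Finset.sum_nonneg fun i _ => abs_nonneg _) (fun v hv h0 => by
      refine hQ v ⟨hv.2, fun i hi => ?_⟩ ?_
      · exact abs_eq_zero.1 ((Finset.sum_eq_zero_iff_of_nonneg fun i _ => abs_nonneg _).1 h0 i hi)
      · rintro rfl
        simp at hv)
  refine ⟨c, hc, M, hM, fun v hv => ?_⟩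
  rcases eq_or_ne v 0 with rfl | hv0
  · simp
  have hn : 0 < ‖v‖ := norm_pos_iff.2 hv0
  have h1 := hle (‖v‖⁻¹ • v) ⟨by simp [norm_smul, hn.ne'], by
    simp [← Finset.mul_sum, hv]⟩
  simp only [map_smul, smul_apply, Pi.smul_apply, smul_eq_mul, abs_mul,
    ← Finset.mul_sum, abs_of_pos (inv_pos.2 hn)] at h1
  have h2 := mul_le_mul_of_nonneg_left h1 (sq_nonneg ‖v‖)
  have e1 : ‖v‖ ^ 2 * (‖v‖⁻¹ * (‖v‖⁻¹ * Q v v)) = Q v v := by field_simp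
  have e2 : ‖v‖ ^ 2 * (-c + M * (‖v‖⁻¹ * ∑ i ∈ zeroSet θs, |v i|)) =
      -c * ‖v‖ ^ 2 + M * (‖v‖ * ∑ i ∈ zeroSet θs, |v i|) := by field_simp
  rwa [e1, e2] at h2

/-! ### Comparison of the model exponent with norms -/

theorem sum_zeroSet_le_gap {d : ℕ} {θs θ : Fin (d + 1) → ℝ} (hθ : ∀ i, 0 ≤ θ i) :
    ∑ i ∈ zeroSet θs, θ i ≤ gap θs θ := by
  have : ∑ i ∈ zeroSet θs, θ i = ∑ i ∈ zeroSet θs, gapTerm (θs i) (θ i) :=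
    Finset.sum_congr rfl fun i hi => by
      rw [gapTerm, if_pos (by simpa [zeroSet] using hi)]
  rw [this]
  exact Finset.sum_le_univ_sum_of_nonneg fun i => gapTerm_nonneg (hθ i)

/-- The sup norm is attained at one coordinate; if that one is active, `x² ≤ x` on `[0, 1]`. -/
theorem norm_sub_sq_le_gap {d : ℕ} {θs θ : Fin (d + 1) → ℝ}
    (hθ : θ ∈ stdSimplex ℝ (Fin (d + 1))) : ‖θ - θs‖ ^ 2 ≤ gap θs θ := by
  obtain ⟨i, hi⟩ : ∃ i, ‖θ - θs‖ = ‖(θ - θs) i‖ := by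
    obtain ⟨i, _, hi⟩ := Finset.exists_mem_eq_sup' (Finset.univ_nonempty (α := Fin (d + 1)))
      (fun i => ‖(θ - θs) i‖₊)
    refine ⟨i, ?_⟩
    rw [Pi.norm_def, ← coe_nnnorm, ← hi, Finset.sup'_eq_sup]
  have h1 : ‖θ - θs‖ ^ 2 ≤ gapTerm (θs i) (θ i) := by
    rw [hi, Real.norm_eq_abs, sq_abs, Pi.sub_apply, gapTerm]
    split_ifs with h0
    · rw [h0, sub_zero]
      nlinarith [hθ.1 i, coord_le_one hθ i]
    · exact le_rfl
  exact h1.trans (Finset.single_le_sum (f := fun i => gapTerm (θs i) (θ i))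
    (fun j _ => gapTerm_nonneg (hθ.1 j)) (Finset.mem_univ i))

theorem gap_le_sum_zeroSet_add {d : ℕ} (θs θ : Fin (d + 1) → ℝ) :
    gap θs θ ≤ ∑ i ∈ zeroSet θs, θ i + (d + 1) * ‖θ - θs‖ ^ 2 := by
  have h1 : ∀ i ∈ Finset.univ, gapTerm (θs i) (θ i) ≤
      (if θs i = 0 then θ i else 0) + ‖θ - θs‖ ^ 2 := by
    intro i _
    have h2 : |θ i - θs i| ≤ ‖θ - θs‖ := norm_le_pi_norm (θ - θs) i
    unfold gapTerm
    split_ifs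
    · linarith [sq_nonneg ‖θ - θs‖]
    · rw [zero_add, ← sq_abs]
      gcongr
  refine (Finset.sum_le_sum h1).trans (le_of_eq ?_)
  rw [Finset.sum_add_distrib, zeroSet, Finset.sum_filter]
  simp

theorem gap_le_card {d : ℕ} {θs θ : Fin (d + 1) → ℝ} (hθs : θs ∈ stdSimplex ℝ (Fin (d + 1)))
    (hθ : θ ∈ stdSimplex ℝ (Fin (d + 1))) : gap θs θ ≤ d + 1 := by
  have : ∀ i ∈ Finset.univ, gapTerm (θs i) (θ i) ≤ 1 := by
    intro i _
    have h1 := coord_le_one hθ i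
    have h2 := coord_le_one hθs i
    have h3 := hθ.1 i
    have h4 := hθs.1 i
    unfold gapTerm
    split_ifs
    · exact h1
    · nlinarith
  refine (Finset.sum_le_card_nsmul _ _ _ this).trans (le_of_eq ?_)
  simp

/-! ### Comparison of `H` with the model exponent -/

section

variable {d : ℕ} {H : (Fin (d + 1) → ℝ) → EReal} {θs : Fin (d + 1) → ℝ}

theorem Assumptions.ne_bot (hH : Assumptions H θs) : H θs ≠ ⊥ := by
  obtain ⟨U, -, hmem, hb, -⟩ := hH.smooth
  exact hb _ hmem

theorem Assumptions.eventually_ne_bot (hH : Assumptions H θs) : ∀ᶠ θ in 𝓝 θs, H θ ≠ ⊥ := by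
  obtain ⟨U, hU, hmem, hb, -⟩ := hH.smooth
  filter_upwards [hU.mem_nhds hmem] with θ hθ using hb θ hθ

theorem Assumptions.contDiffAt (hH : Assumptions H θs) :
    ContDiffAt ℝ 2 (fun θ => (H θ).toReal) θs := by
  obtain ⟨U, hU, hmem, -, hc⟩ := hH.smooth
  exact hc.contDiffAt (hU.mem_nhds hmem)

theorem Assumptions.toReal_le (hH : Assumptions H θs) {θ : Fin (d + 1) → ℝ}
    (hθ : θ ∈ stdSimplex ℝ (Fin (d + 1))) (hb : H θ ≠ ⊥) :
    (H θ).toReal ≤ (H θs).toReal := by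
  rcases eq_or_ne θ θs with rfl | hne
  · exact le_rfl
  · exact EReal.toReal_le_toReal (hH.unique_max θ hθ hne).le hb (hH.ne_top _)

theorem Assumptions.exists_isKKT (hH : Assumptions H θs) : ∃ (lam : Fin (d + 1) → ℝ) (μ : ℝ),
    IsKKT (fun θ => (H θ).toReal) θs lam μ := by
  refine DirichletIS.exists_isKKT hH.mem_simplex (hH.contDiffAt.differentiableAt (by norm_num)) ?_
  refine eventually_nhdsWithin_iff.2 ?_
  filter_upwards [hH.eventually_ne_bot] with θ hb hθ
  exact hH.toReal_le hθ hb

theorem sum_sub_eq_zero {θ : Fin (d + 1) → ℝ} (hθ : θ ∈ stdSimplex ℝ (Fin (d + 1)))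
    (hθs : θs ∈ stdSimplex ℝ (Fin (d + 1))) : ∑ i, (θ - θs) i = 0 := by
  simp [Finset.sum_sub_distrib, hθ.2, hθs.2]

theorem sum_zeroSet_sub (θ lam : Fin (d + 1) → ℝ) :
    ∑ i ∈ zeroSet θs, lam i * (θ - θs) i = ∑ i ∈ zeroSet θs, lam i * θ i :=
  Finset.sum_congr rfl fun i hi => by
    have : θs i = 0 := by simpa [zeroSet] using hi
    simp [this]

theorem sum_zeroSet_abs_sub {θ : Fin (d + 1) → ℝ} (hθ : ∀ i, 0 ≤ θ i) :
    ∑ i ∈ zeroSet θs, |(θ - θs) i| = ∑ i ∈ zeroSet θs, θ i :=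
  Finset.sum_congr rfl fun i hi => by
    have : θs i = 0 := by simpa [zeroSet] using hi
    simp [this, abs_of_nonneg (hθ i)]

theorem exists_pos_forall_le {ι : Type*} (s : Finset ι) (f : ι → ℝ) (hf : ∀ i ∈ s, 0 < f i) :
    ∃ c > 0, ∀ i ∈ s, c ≤ f i := by
  rcases s.eq_empty_or_nonempty with rfl | hs
  · exact ⟨1, one_pos, by simp⟩
  · obtain ⟨i, hi, hmin⟩ := s.exists_min_image f hs
    exact ⟨f i, hf i hi, hmin⟩

/-- Let `p` be the sum of the active coordinates and `r = ‖θ - θs‖`. The first order term is at most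
`-l p` with `l > 0`. The Hessian term is at most `(-c r² + M r p) / 2`, and its cross term is at
most `l p / 2` once `r < l / (M + 1)`. With Taylor error `c r² / 4` there remains `-(l/2) p - (c/4)
r²`, which dominates `gap ≤ p + (d + 1) r²` with the stated minimum as constant. -/
theorem Assumptions.eventually_le_sub_gap (hH : Assumptions H θs) :
    ∃ c > 0, ∀ᶠ θ in 𝓝 θs, θ ∈ stdSimplex ℝ (Fin (d + 1)) →
      (H θ).toReal ≤ (H θs).toReal - c * gap θs θ := by
  obtain ⟨lam, μ, hk⟩ := hH.exists_isKKT
  have hlam := hH.strict_compl lam μ hk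
  obtain ⟨l, hl, hll⟩ := exists_pos_forall_le _ _ hlam
  obtain ⟨c, hc, M, hM, hQ⟩ := exists_quadratic_bound θs
    (fderiv ℝ (fderiv ℝ fun θ => (H θ).toReal) θs) (fun v hv hv0 => by
      have := hH.neg_def v hv hv0
      rwa [iteratedFDeriv_two_apply] at this)
  have hT := taylor_second_order hH.contDiffAt (ε := c / 4) (by positivity)
  refine ⟨min (l / 2) (c / (4 * (d + 1))), by positivity, ?_⟩
  filter_upwards [hT, Metric.ball_mem_nhds θs (show 0 < l / (M + 1) by positivity)]
    with θ hθT hball hθ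
  rw [mem_ball_iff_norm, lt_div_iff₀ (by positivity)] at hball
  have h0 := sum_sub_eq_zero hθ hH.mem_simplex
  have h1 := hQ _ h0
  rw [hk.fderiv_apply h0, sum_zeroSet_sub] at hθT
  rw [sum_zeroSet_abs_sub hθ.1] at h1
  have h2 := (abs_le.1 hθT).2
  have h3 : l * ∑ i ∈ zeroSet θs, θ i ≤ ∑ i ∈ zeroSet θs, lam i * θ i := by
    rw [Finset.mul_sum]
    exact Finset.sum_le_sum fun i hi => mul_le_mul_of_nonneg_right (hll i hi) (hθ.1 i)
  have h4 := gap_le_sum_zeroSet_add θs θ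
  have hp : 0 ≤ ∑ i ∈ zeroSet θs, θ i := Finset.sum_nonneg fun i _ => hθ.1 i
  set p := ∑ i ∈ zeroSet θs, θ i
  set r := ‖θ - θs‖
  have h5 : M * (r * p) ≤ l * p := by
    rw [← mul_assoc]
    have : 0 ≤ r := norm_nonneg _
    gcongr
    nlinarith
  have hm1 := min_le_left (l / 2) (c / (4 * ((d : ℝ) + 1)))
  have hm2 := min_le_right (l / 2) (c / (4 * ((d : ℝ) + 1)))
  have hm0 : 0 < min (l / 2) (c / (4 * ((d : ℝ) + 1))) := by positivity
  set m := min (l / 2) (c / (4 * ((d : ℝ) + 1)))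
  have h6 : m * gap θs θ ≤ l / 2 * p + c / 4 * r ^ 2 := by
    calc m * gap θs θ ≤ m * (p + (d + 1) * r ^ 2) := by gcongr
      _ = m * p + m * ((d + 1) * r ^ 2) := by ring
      _ ≤ l / 2 * p + c / (4 * ((d : ℝ) + 1)) * ((d + 1) * r ^ 2) := by gcongr
      _ = _ := by field_simp
  linarith

/-- Only the sizes of the multipliers and of the Hessian matter, since `gap` bounds both the active
coordinates and `‖θ - θs‖²`; the final `1` in the constant is the Taylor error. -/
theorem Assumptions.eventually_sub_gap_le (hH : Assumptions H θs) :
    ∃ L > 0, ∀ᶠ θ in 𝓝 θs, θ ∈ stdSimplex ℝ (Fin (d + 1)) →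
      (H θs).toReal - L * gap θs θ ≤ (H θ).toReal := by
  obtain ⟨lam, μ, hk⟩ := hH.exists_isKKT
  have hT := taylor_second_order hH.contDiffAt (ε := 1) one_pos
  set Q := fderiv ℝ (fderiv ℝ fun θ => (H θ).toReal) θs
  set S := ∑ i ∈ zeroSet θs, lam i
  have hS : 0 ≤ S := Finset.sum_nonneg hk.1
  refine ⟨S + ‖Q‖ / 2 + 1, by positivity, ?_⟩
  filter_upwards [hT] with θ hθT hθ
  have h0 := sum_sub_eq_zero hθ hH.mem_simplex
  rw [hk.fderiv_apply h0, sum_zeroSet_sub] at hθT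
  have h2 := (abs_le.1 hθT).1
  have hg := norm_sub_sq_le_gap (θs := θs) hθ
  have h3 : -(‖Q‖ * gap θs θ) ≤ Q (θ - θs) (θ - θs) := by
    have h4 := Q.le_opNorm₂ (θ - θs) (θ - θs)
    rw [Real.norm_eq_abs] at h4
    have h5 : ‖Q‖ * ‖θ - θs‖ * ‖θ - θs‖ ≤ ‖Q‖ * gap θs θ := by
      rw [mul_assoc, ← sq]; gcongr
    linarith [neg_abs_le (Q (θ - θs) (θ - θs))]
  have h4 : ∑ i ∈ zeroSet θs, lam i * θ i ≤ S * gap θs θ := by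
    rw [Finset.sum_mul]
    refine Finset.sum_le_sum fun i hi => mul_le_mul_of_nonneg_left ?_ (hk.1 i hi)
    exact (Finset.single_le_sum (fun j _ => hθ.1 j) hi).trans (sum_zeroSet_le_gap hθ.1)
  linarith

/-- Off a neighborhood of `θs`, compactness and uniqueness of the maximizer keep `H` below its
maximum by a fixed amount, while `gap ≤ d + 1`. -/
theorem Assumptions.le_sub_gap (hH : Assumptions H θs) :
    ∃ c > 0, ∀ θ ∈ stdSimplex ℝ (Fin (d + 1)), H θ ≠ ⊥ →
      (H θ).toReal ≤ (H θs).toReal - c * gap θs θ := by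
  obtain ⟨c, hc, hloc⟩ := hH.eventually_le_sub_gap
  obtain ⟨W, hW, hWo, hWs⟩ := eventually_nhds_iff.1 hloc
  have hcomp : IsCompact (stdSimplex ℝ (Fin (d + 1)) \ W) :=
    (isCompact_stdSimplex ℝ (Fin (d + 1))).diff hWo
  rcases (stdSimplex ℝ (Fin (d + 1)) \ W).eq_empty_or_nonempty with he | hne
  · refine ⟨c, hc, fun θ hθ _ => hW θ ?_ hθ⟩
    by_contra hn
    exact Set.eq_empty_iff_forall_notMem.1 he θ ⟨hθ, hn⟩
  · obtain ⟨θ₀, hθ₀, hmax⟩ := hcomp.exists_isMaxOn hne (hH.continuousOn.mono Set.sdiff_subset)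
    have hlt := hH.unique_max θ₀ hθ₀.1 (fun h => hθ₀.2 (h ▸ hWs))
    -- The maximum off `W` may be `⊥`, so a real number strictly between the two values is used
    -- instead.
    obtain ⟨r, hr1, hr2⟩ := EReal.lt_iff_exists_real_btwn.1 hlt
    have hr : r < (H θs).toReal := by
      rw [← EReal.coe_lt_coe_iff, EReal.coe_toReal (hH.ne_top _) hH.ne_bot]
      exact hr2
    have hr' := sub_pos.2 hr
    refine ⟨min c (((H θs).toReal - r) / (d + 1)), by positivity, fun θ hθ hb => ?_⟩
    have hg := gap_nonneg (θs := θs) hθ.1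
    by_cases hθW : θ ∈ W
    · have h1 := hW θ hθW hθ
      have := mul_le_mul_of_nonneg_right (min_le_left c (((H θs).toReal - r) / (d + 1))) hg
      linarith
    · have h1 : H θ ≤ r := (hmax ⟨hθ, hθW⟩).trans hr1.le
      have h2 : (H θ).toReal ≤ r := by
        simpa using EReal.toReal_le_toReal h1 hb (EReal.coe_ne_top r)
      have h3 : min c (((H θs).toReal - r) / (d + 1)) * gap θs θ ≤ (H θs).toReal - r := by
        calc _ ≤ ((H θs).toReal - r) / (d + 1) * (d + 1) := by
              gcongr
              · exact min_le_right _ _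
              · exact gap_le_card hH.mem_simplex hθ
          _ = _ := by field_simp
      linarith

end

section

/-! ### The relative entropy and the proposal normalization -/

/-- The relative entropy of `θs` with respect to `θ`. -/
def relEntropy {d : ℕ} (θs θ : Fin (d + 1) → ℝ) : ℝ := ∑ i, θs i * Real.log (θs i / θ i)

variable {d : ℕ} {α θs : Fin (d + 1) → ℝ}

theorem measurable_relEntropy (θs : Fin (d + 1) → ℝ) : Measurable (relEntropy θs) := by
  unfold relEntropy
  fun_prop

theorem sum_sub_eq_zero' {θ : Fin (d + 1) → ℝ} (hθ : θ ∈ stdSimplex ℝ (Fin (d + 1)))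
    (hθs : θs ∈ stdSimplex ℝ (Fin (d + 1))) : ∑ i, (θs i - θ i) = 0 := by
  rw [Finset.sum_sub_distrib, hθ.2, hθs.2, sub_self]

/-- With `s = √x`, `-log x = -2 log s ≥ 2 (1 - s) = (1 - x) + (1 - s)²`, and `(1 - x)² = (1 - s)² (1
+ s)²` with `(1 + s)² ≤ 2 + 2 x`. -/
theorem one_sub_add_sq_div_le_neg_log {x B : ℝ} (hx : 0 < x) (hB : x ≤ B) :
    (1 - x) + (1 - x) ^ 2 / (2 + 2 * B) ≤ -Real.log x := by
  have hs := Real.sqrt_pos.2 hx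
  have hsq := Real.sq_sqrt hx.le
  set s := √x
  have h1 : Real.log x = 2 * Real.log s := by rw [← hsq, Real.log_pow]; norm_num
  have h2 := Real.log_le_sub_one_of_pos hs
  have h3 : (1 - x) ^ 2 / (2 + 2 * B) ≤ (1 - s) ^ 2 := by
    rw [div_le_iff₀ (by linarith)]
    have e : (1 - x) ^ 2 = (1 - s) ^ 2 * (1 + s) ^ 2 := by rw [← hsq]; ring
    rw [e]
    gcongr
    nlinarith [sq_nonneg (1 - s)]
  rw [h1]
  nlinarith

/-- Adding the linear terms `θs i - θ i`, whose sum is zero, makes the bound hold coordinatewise. An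
active coordinate has zero entropy term but linear term `-θ i`, which pays for `c * θ i` because `c
≤ 1`. The other coordinates use the preceding logarithm bound at `θ i / θs i`. -/
theorem exists_mul_gap_le_relEntropy (hθs : θs ∈ stdSimplex ℝ (Fin (d + 1))) :
    ∃ c > 0, ∀ θ ∈ stdSimplex ℝ (Fin (d + 1)), (∀ i, 0 < θ i) →
      c * gap θs θ ≤ relEntropy θs θ := by
  obtain ⟨b, hb, hbl⟩ := exists_pos_forall_le (Finset.univ.filter fun i => θs i ≠ 0) θs
    fun i hi => lt_of_le_of_ne (hθs.1 i) (Ne.symm (by simpa using hi))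
  set c : ℝ := 1 / (2 + 2 * b⁻¹) with hc
  have hc0 : 0 < c := by positivity
  have hc1 : c ≤ 1 := by
    rw [hc, div_le_one (by positivity)]
    have : 0 < b⁻¹ := by positivity
    linarith
  refine ⟨c, hc0, fun θ hθ hpos => ?_⟩
  have key : ∀ i ∈ Finset.univ, (θs i - θ i) + c * gapTerm (θs i) (θ i) ≤
      θs i * Real.log (θs i / θ i) := by
    intro i _
    unfold gapTerm
    split_ifs with h0
    · rw [h0]
      nlinarith [hpos i]
    · have ha : 0 < θs i := lt_of_le_of_ne (hθs.1 i) (Ne.symm h0)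
      have ha1 := coord_le_one hθs i
      have hx : θ i / θs i ≤ b⁻¹ := by
        rw [div_eq_mul_inv]
        have h1 : (θs i)⁻¹ ≤ b⁻¹ := inv_anti₀ hb (hbl i (by simpa using h0))
        calc _ ≤ 1 * b⁻¹ := mul_le_mul (coord_le_one hθ i) h1 (by positivity) zero_le_one
          _ = _ := one_mul _
      have h2 := one_sub_add_sq_div_le_neg_log (div_pos (hpos i) ha) hx
      rw [← Real.log_inv, inv_div] at h2
      have h3 := mul_le_mul_of_nonneg_left h2 ha.le
      refine le_trans ?_ h3
      have e : θs i * (1 - θ i / θs i + (1 - θ i / θs i) ^ 2 / (2 + 2 * b⁻¹)) =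
          (θs i - θ i) + c * ((θ i - θs i) ^ 2 / θs i) := by
        rw [hc]; field_simp; ring
      rw [e]
      gcongr
      rw [le_div_iff₀ ha]
      exact mul_le_of_le_one_right (sq_nonneg _) ha1
  have := Finset.sum_le_sum key
  rw [Finset.sum_add_distrib, sum_sub_eq_zero' hθ hθs, zero_add, ← Finset.mul_sum] at this
  exact this

theorem relEntropy_nonneg (hθs : θs ∈ stdSimplex ℝ (Fin (d + 1))) {θ : Fin (d + 1) → ℝ}
    (hθ : θ ∈ stdSimplex ℝ (Fin (d + 1))) (hpos : ∀ i, 0 < θ i) : 0 ≤ relEntropy θs θ := by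
  obtain ⟨c, hc, hle⟩ := exists_mul_gap_le_relEntropy hθs
  exact (mul_nonneg hc.le (gap_nonneg hθ.1)).trans (hle θ hθ hpos)

/-- From `log u ≤ u - 1`, each term with `θs i > 0` is at most `(θs i - θ i) + (θ i - θs i)² / θ i`,
where `θ i ≥ ε`. The linear terms sum to zero; in an active coordinate the summand `1` of the
constant compensates `-θ i`. -/
theorem relEntropy_le (hθs : θs ∈ stdSimplex ℝ (Fin (d + 1))) {ε : ℝ} (hε : 0 < ε)
    {θ : Fin (d + 1) → ℝ} (hθ : θ ∈ stdSimplex ℝ (Fin (d + 1)))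
    (hle : ∀ i, 0 < θs i → ε ≤ θ i) : relEntropy θs θ ≤ (1 + ε⁻¹) * gap θs θ := by
  have key : ∀ i ∈ Finset.univ, θs i * Real.log (θs i / θ i) ≤
      (θs i - θ i) + (1 + ε⁻¹) * gapTerm (θs i) (θ i) := by
    intro i _
    have hε' : 0 < ε⁻¹ := by positivity
    unfold gapTerm
    split_ifs with h0
    · rw [h0]
      nlinarith [hθ.1 i]
    · have ha : 0 < θs i := lt_of_le_of_ne (hθs.1 i) (Ne.symm h0)
      have hx := hle i ha
      have hx0 : 0 < θ i := by linarith
      have h1 := mul_le_mul_of_nonneg_left (Real.log_le_sub_one_of_pos (div_pos ha hx0)) ha.le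
      refine h1.trans ?_
      have e : θs i * (θs i / θ i - 1) = (θs i - θ i) + (θ i)⁻¹ * (θ i - θs i) ^ 2 := by
        field_simp; ring
      rw [e]
      have h2 : (θ i)⁻¹ ≤ 1 + ε⁻¹ := (inv_anti₀ hε hx).trans (by linarith)
      gcongr
  have := Finset.sum_le_sum key
  rwa [Finset.sum_add_distrib, sum_sub_eq_zero' hθ hθs, zero_add, ← Finset.mul_sum] at this

theorem prod_rpow_eq_mul_exp_relEntropy (hθs : ∀ i, 0 ≤ θs i) {θ : Fin (d + 1) → ℝ}
    (hpos : ∀ i, 0 < θ i) (t : ℝ) :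
    ∏ i, θ i ^ (t * θs i) = (∏ i, θs i ^ (t * θs i)) * Real.exp (-(t * relEntropy θs θ)) := by
  rw [relEntropy, Finset.mul_sum, ← Finset.sum_neg_distrib, Real.exp_sum,
    ← Finset.prod_mul_distrib]
  refine Finset.prod_congr rfl fun i _ => ?_
  rcases (hθs i).eq_or_lt with h0 | h0
  · simp [← h0]
  · rw [Real.rpow_def_of_pos (hpos i), Real.rpow_def_of_pos h0, ← Real.exp_add,
      Real.log_div h0.ne' (hpos i).ne']
    congr 1; ring

/-- The Laplace transform of the relative entropy under the Dirichlet distribution. -/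
def entropyLaplace (α θs : Fin (d + 1) → ℝ) (t : ℝ) : ℝ :=
  ∫ θ, Real.exp (-(t * relEntropy θs θ)) ∂dirichlet α

theorem integrable_dirichlet (hα : ∀ i, 0 < α i) {f : (Fin (d + 1) → ℝ) → ℝ}
    (hf : AEStronglyMeasurable f (dirichlet α)) (C : ℝ)
    (hb : ∀ θ ∈ stdSimplex ℝ (Fin (d + 1)), (∀ i, 0 < θ i) → 0 ≤ f θ ∧ f θ ≤ C) :
    Integrable f (dirichlet α) := by
  have := isProbabilityMeasure_dirichlet hα
  refine Integrable.of_bound hf C ?_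
  filter_upwards [ae_dirichlet α] with θ hθ
  rw [Real.norm_of_nonneg (hb θ hθ.1 hθ.2).1]
  exact (hb θ hθ.1 hθ.2).2

theorem integral_dirichlet_mono {f g : (Fin (d + 1) → ℝ) → ℝ} (hg : Integrable g (dirichlet α))
    (hb : ∀ θ ∈ stdSimplex ℝ (Fin (d + 1)), (∀ i, 0 < θ i) → 0 ≤ f θ ∧ f θ ≤ g θ) :
    ∫ θ, f θ ∂dirichlet α ≤ ∫ θ, g θ ∂dirichlet α := by
  refine integral_mono_of_nonneg ?_ hg ?_
  · filter_upwards [ae_dirichlet α] with θ hθ using (hb θ hθ.1 hθ.2).1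
  · filter_upwards [ae_dirichlet α] with θ hθ using (hb θ hθ.1 hθ.2).2

theorem integrable_exp_neg_gap (hα : ∀ i, 0 < α i) (θs : Fin (d + 1) → ℝ) {n : ℝ} (hn : 0 ≤ n) :
    Integrable (fun θ => Real.exp (-(n * gap θs θ))) (dirichlet α) := by
  refine integrable_dirichlet hα ?_ 1 fun θ hθ _ => ⟨(Real.exp_pos _).le, ?_⟩
  · have := measurable_gap θs
    exact Measurable.aestronglyMeasurable (by fun_prop)
  · rw [Real.exp_le_one_iff]
    have := mul_nonneg hn (gap_nonneg (θs := θs) hθ.1)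
    linarith

theorem integrable_exp_neg_relEntropy (hα : ∀ i, 0 < α i) (hθs : θs ∈ stdSimplex ℝ (Fin (d + 1)))
    {t : ℝ} (ht : 0 ≤ t) :
    Integrable (fun θ => Real.exp (-(t * relEntropy θs θ))) (dirichlet α) := by
  refine integrable_dirichlet hα ?_ 1 fun θ hθ hpos => ⟨(Real.exp_pos _).le, ?_⟩
  · have := measurable_relEntropy θs
    exact Measurable.aestronglyMeasurable (by fun_prop)
  · rw [Real.exp_le_one_iff]
    have := mul_nonneg ht (relEntropy_nonneg hθs hθ hpos)
    linarith

theorem exists_entropyLaplace_le (hα : ∀ i, 0 < α i) (hθs : θs ∈ stdSimplex ℝ (Fin (d + 1))) :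
    ∃ C > 0, ∀ᶠ t : ℝ in atTop, entropyLaplace α θs t ≤ C * t ^ (-decayExp α θs) := by
  obtain ⟨C, hC, hle⟩ := exists_integral_exp_gap_le hα hθs
  obtain ⟨c, hc, hcle⟩ := exists_mul_gap_le_relEntropy hθs
  refine ⟨C * c ^ (-decayExp α θs), by positivity, ?_⟩
  filter_upwards [eventually_ge_atTop 0, eventually_ge_atTop c⁻¹] with t ht0 ht
  have h1 : 1 ≤ t * c := by rwa [inv_le_iff_one_le_mul₀ hc] at ht
  refine (integral_dirichlet_mono (integrable_exp_neg_gap hα θs (by positivity))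
    fun θ hθ hpos => ⟨(Real.exp_pos _).le, ?_⟩).trans ((hle _ h1).trans (le_of_eq ?_))
  · rw [Real.exp_le_exp, neg_le_neg_iff, mul_assoc]
    exact mul_le_mul_of_nonneg_left (hcle θ hθ hpos) ht0
  · rw [Real.mul_rpow ht0 hc.le]; ring

theorem exists_le_entropyLaplace (hα : ∀ i, 0 < α i) (hθs : θs ∈ stdSimplex ℝ (Fin (d + 1))) :
    ∃ c > 0, ∀ᶠ t : ℝ in atTop, c * t ^ (-decayExp α θs) ≤ entropyLaplace α θs t := by
  obtain ⟨b, hb, hbl⟩ := exists_pos_forall_le (Finset.univ.filter fun i => 0 < θs i) θs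
    fun i hi => by simpa using hi
  -- Within `b / 2` of `θs` every coordinate of the support is at least `b / 2`, so `relEntropy_le`
  -- applies with that threshold.
  obtain ⟨c, hc, hle⟩ := exists_le_integral_exp_gap hα hθs (L := 1 + (b / 2)⁻¹) (δ := b / 2)
    (by positivity) (by positivity)
  refine ⟨c, hc, ?_⟩
  filter_upwards [hle, eventually_ge_atTop 0] with t ht ht0
  refine ht.trans (integral_dirichlet_mono (integrable_exp_neg_relEntropy hα hθs ht0)
    fun θ hθ hpos => ⟨Set.indicator_nonneg (fun _ _ => (Real.exp_pos _).le) _, ?_⟩)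
  by_cases hV : ∀ i, |θ i - θs i| < b / 2
  · rw [Set.indicator_of_mem (by exact hV), Real.exp_le_exp, neg_le_neg_iff]
    refine mul_le_mul_of_nonneg_left (relEntropy_le hθs (by positivity) hθ fun i hi => ?_) ht0
    have h1 := hbl i (by simpa using hi)
    have h2 := (abs_lt.1 (hV i)).1
    linarith
  · rw [Set.indicator_of_notMem (by exact hV)]
    exact (Real.exp_pos _).le

theorem dirDensity_add_mul (hα : ∀ i, 0 < α i) (hθs : ∀ i, 0 ≤ θs i) {t : ℝ}
    {θ : Fin (d + 1) → ℝ} (hpos : ∀ i, 0 < θ i) :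
    dirDensity (fun i => α i + t * θs i) θ = dirDensity α θ *
      (multiBeta α / multiBeta (fun i => α i + t * θs i) * (∏ i, θs i ^ (t * θs i)) *
        Real.exp (-(t * relEntropy θs θ))) := by
  have hB := multiBeta_pos hα
  have : ∏ i, θ i ^ (α i + t * θs i - 1) =
      (∏ i, θ i ^ (α i - 1)) * ∏ i, θ i ^ (t * θs i) := by
    rw [← Finset.prod_mul_distrib]
    refine Finset.prod_congr rfl fun i _ => ?_
    rw [← Real.rpow_add (hpos i)]; congr 1; ring
  rw [dirDensity, dirDensity, this, prod_rpow_eq_mul_exp_relEntropy hθs hpos]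
  field_simp

theorem param_add_pos (hα : ∀ i, 0 < α i) (hθs : ∀ i, 0 ≤ θs i) {t : ℝ} (ht : 0 ≤ t)
    (i : Fin (d + 1)) : 0 < α i + t * θs i :=
  add_pos_of_pos_of_nonneg (hα i) (mul_nonneg ht (hθs i))

/-- The proposal density is `dirDensity α` times a constant times `exp(-t relEntropy)`; since the
proposal has mass one, the constant is the inverse of `entropyLaplace`. This replaces Stirling's
formula for the Beta functions. -/
theorem multiBeta_div_mul_entropyLaplace (hα : ∀ i, 0 < α i) (hθs : ∀ i, 0 ≤ θs i) {t : ℝ}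
    (ht : 0 ≤ t) :
    multiBeta α / multiBeta (fun i => α i + t * θs i) * (∏ i, θs i ^ (t * θs i)) *
      entropyLaplace α θs t = 1 := by
  have hη := param_add_pos hα hθs ht
  have := isProbabilityMeasure_dirichlet hη
  rw [entropyLaplace, ← integral_const_mul, ← integral_dirichlet_change hα hη (f := fun _ => 1)]
  · simp
  · intro θ _ hpos
    rw [mul_one, dirDensity_add_mul hα hθs hpos]

theorem dirDensity_pos (hα : ∀ i, 0 < α i) {θ : Fin (d + 1) → ℝ} (hpos : ∀ i, 0 < θ i) :
    0 < dirDensity α θ :=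
  mul_pos (one_div_pos.2 (multiBeta_pos hα)) (Finset.prod_pos fun i _ =>
    Real.rpow_pos_of_pos (hpos i) _)

theorem dirDensity_div (hα : ∀ i, 0 < α i) (hθs : ∀ i, 0 ≤ θs i) {t : ℝ} (ht : 0 ≤ t)
    {θ : Fin (d + 1) → ℝ} (hpos : ∀ i, 0 < θ i) :
    dirDensity α θ / dirDensity (fun i => α i + t * θs i) θ =
      entropyLaplace α θs t * Real.exp (t * relEntropy θs θ) := by
  have h1 := multiBeta_div_mul_entropyLaplace hα hθs ht
  have h2 := dirDensity_pos (param_add_pos hα hθs ht) hpos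
  have h3 := dirDensity_add_mul hα hθs (t := t) hpos
  rw [div_eq_iff h2.ne', h3]
  have h4 : Real.exp (t * relEntropy θs θ) * Real.exp (-(t * relEntropy θs θ)) = 1 := by
    rw [← Real.exp_add, add_neg_cancel, Real.exp_zero]
  linear_combination (-dirDensity α θ) * h1 * (Real.exp (t * relEntropy θs θ) *
    Real.exp (-(t * relEntropy θs θ))) - dirDensity α θ * h4

end

/-! ### Mean squared error of sample means -/

theorem mse_sampleMean {d N : ℕ} (hN : 1 ≤ N) (ν : Measure (Fin (d + 1) → ℝ))
    [IsProbabilityMeasure ν] {X : (Fin (d + 1) → ℝ) → ℝ} (hX : MemLp X 2 ν) (T : ℝ) :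
    mse (N := N) ν (fun s => (1 / (N : ℝ)) * ∑ i, X (s i)) T =
      (1 / N) * (∫ θ, X θ ^ 2 ∂ν - (∫ θ, X θ ∂ν) ^ 2) + (∫ θ, X θ ∂ν - T) ^ 2 := by
  have hN0 : (N : ℝ) ≠ 0 := by positivity
  set P := Measure.pi fun _ : Fin N => ν
  have hmp : ∀ i : Fin N, MeasurePreserving (Function.eval i) P ν := fun i =>
    measurePreserving_eval _ i
  have hXi : ∀ i : Fin N, MemLp (fun s : Fin N → Fin (d + 1) → ℝ => X (s i)) 2 P := fun i =>
    hX.comp_measurePreserving (hmp i)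
  have hint : ∀ i : Fin N, ∫ s, X (s i) ∂P = ∫ θ, X θ ∂ν := fun i => by
    have h := integral_map (hmp i).measurable.aemeasurable (f := X)
      (by rw [(hmp i).map_eq]; exact hX.aestronglyMeasurable)
    rw [(hmp i).map_eq] at h
    exact h.symm
  set Y : (Fin N → Fin (d + 1) → ℝ) → ℝ := ∑ i, fun s => X (s i)
  have hYs : ∀ s, Y s = ∑ i, X (s i) := fun s => by simp [Y]
  have hY : MemLp Y 2 P := memLp_finsetSum' _ fun i _ => hXi i
  have hvar : ProbabilityTheory.variance Y P = N * ProbabilityTheory.variance X ν := by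
    -- Independence enters here; the rest expands the square with the second moment recovered from
    -- the variance.
    rw [ProbabilityTheory.variance_sum_pi fun _ => hX]
    simp
  have hmean : ∫ s, Y s ∂P = N * ∫ θ, X θ ∂ν := by
    simp_rw [hYs]
    rw [integral_finsetSum _ fun i _ => (hXi i).integrable (by norm_num)]
    simp [hint]
  rw [ProbabilityTheory.variance_eq_sub hY, ProbabilityTheory.variance_eq_sub hX, hmean] at hvar
  simp only [Pi.pow_apply] at hvar
  have hY1 := hY.integrable (by norm_num)
  have hY2 := hY.integrable_sq
  unfold mse
  simp_rw [← hYs]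
  have e : ∀ s, (1 / (N : ℝ) * Y s - T) ^ 2 =
      (1 / (N : ℝ)) ^ 2 * Y s ^ 2 - (2 * T / N) * Y s + T ^ 2 := fun s => by ring
  simp_rw [e]
  have hI : Integrable (fun s => (1 / (N : ℝ)) ^ 2 * Y s ^ 2 - (2 * T / N) * Y s) P :=
    (hY2.const_mul _).sub (hY1.const_mul _)
  rw [integral_add hI (integrable_const _), integral_sub (hY2.const_mul _) (hY1.const_mul _), integral_const_mul, integral_const_mul,
    integral_const, hmean]
  have h2 : ∫ s, Y s ^ 2 ∂P = N * (∫ θ, X θ ^ 2 ∂ν - (∫ θ, X θ ∂ν) ^ 2) +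
      (N * ∫ θ, X θ ∂ν) ^ 2 := by linarith
  rw [h2]
  simp
  field_simp
  ring

/-! ### Moments of the two estimators -/

section

variable {d : ℕ} {α θs : Fin (d + 1) → ℝ} {H : (Fin (d + 1) → ℝ) → EReal}

theorem expH_nonneg (H : (Fin (d + 1) → ℝ) → EReal) (n : ℝ) (θ : Fin (d + 1) → ℝ) :
    0 ≤ expH H n θ := by
  unfold expH; split_ifs <;> positivity

theorem expH_sq (H : (Fin (d + 1) → ℝ) → EReal) (n : ℝ) (θ : Fin (d + 1) → ℝ) :
    expH H n θ ^ 2 = expH H (2 * n) θ := by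
  unfold expH
  split_ifs
  · norm_num
  · rw [← Real.exp_nat_mul]; congr 1; push_cast; ring

theorem isClosed_truncSimplex (θs : Fin (d + 1) → ℝ) (ε : ℝ) : IsClosed (truncSimplex θs ε) := by
  have : truncSimplex θs ε = stdSimplex ℝ (Fin (d + 1)) ∩ ⋂ i, ⋂ (_ : 0 < θs i), {θ | ε ≤ θ i} := by
    ext; simp [truncSimplex]
  rw [this]
  exact (isClosed_stdSimplex ℝ (Fin (d + 1))).inter (isClosed_iInter fun i => isClosed_iInter
    fun _ => isClosed_le continuous_const (continuous_apply i))

/-- Nothing is known about `H` away from the simplex and `θs`, so `H` is replaced by `⊥` off the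
simplex, which the Dirichlet law does not charge. -/
theorem aestronglyMeasurable_expH (hc : ContinuousOn H (stdSimplex ℝ (Fin (d + 1)))) (n : ℝ)
    (η : Fin (d + 1) → ℝ) : AEStronglyMeasurable (expH H n) (dirichlet η) := by
  classical
  have hS : MeasurableSet (stdSimplex ℝ (Fin (d + 1))) := (isClosed_stdSimplex ℝ _).measurableSet
  have h1 : Measurable ((stdSimplex ℝ (Fin (d + 1))).piecewise H fun _ => (⊥ : EReal)) :=
    hc.measurable_piecewise continuousOn_const hS
  have h2 : Measurable fun x : EReal => if x = ⊥ then (0 : ℝ) else Real.exp (n * x.toReal) :=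
    Measurable.ite (measurableSet_singleton ⊥) measurable_const
      ((measurable_ereal_toReal.const_mul n).exp)
  refine ⟨_, (h2.comp h1).stronglyMeasurable, ?_⟩
  filter_upwards [ae_dirichlet η] with θ hθ
  simp [expH, Set.piecewise, hθ.1]

theorem Assumptions.exists_expH_le (hH : Assumptions H θs) :
    ∃ c > 0, ∀ n ≥ 0, ∀ θ ∈ stdSimplex ℝ (Fin (d + 1)),
      expH H n θ ≤ Real.exp (n * (H θs).toReal) * Real.exp (-(n * (c * gap θs θ))) := by
  obtain ⟨c, hc, hle⟩ := hH.le_sub_gap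
  refine ⟨c, hc, fun n hn θ hθ => ?_⟩
  unfold expH
  split_ifs with hb
  · positivity
  · rw [← Real.exp_add, Real.exp_le_exp]
    have := mul_le_mul_of_nonneg_left (hle θ hθ hb) hn
    linarith

theorem Assumptions.exists_le_expH (hH : Assumptions H θs) :
    ∃ L > 0, ∃ δ > 0, ∀ n ≥ 0, ∀ θ ∈ stdSimplex ℝ (Fin (d + 1)), (∀ i, |θ i - θs i| < δ) →
      Real.exp (n * (H θs).toReal) * Real.exp (-(n * (L * gap θs θ))) ≤ expH H n θ := by
  obtain ⟨L, hL, hev⟩ := hH.eventually_sub_gap_le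
  obtain ⟨δ, hδ, hball⟩ := Metric.eventually_nhds_iff_ball.1 (hev.and hH.eventually_ne_bot)
  refine ⟨L, hL, δ, hδ, fun n hn θ hθ hV => ?_⟩
  obtain ⟨h1, h2⟩ := hball θ (by
    rw [mem_ball_iff_norm, pi_norm_lt_iff hδ]; exact hV)
  rw [expH, if_neg h2, ← Real.exp_add, Real.exp_le_exp]
  have := mul_le_mul_of_nonneg_left (h1 hθ) hn
  linarith

theorem Assumptions.expH_le (hH : Assumptions H θs) {n : ℝ} (hn : 0 ≤ n) {θ : Fin (d + 1) → ℝ}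
    (hθ : θ ∈ stdSimplex ℝ (Fin (d + 1))) : expH H n θ ≤ Real.exp (n * (H θs).toReal) := by
  obtain ⟨c, hc, hle⟩ := hH.exists_expH_le
  refine (hle n hn θ hθ).trans (mul_le_of_le_one_right (Real.exp_pos _).le ?_)
  rw [Real.exp_le_one_iff]
  have := mul_nonneg hn (mul_nonneg hc.le (gap_nonneg (θs := θs) hθ.1))
  linarith

theorem Assumptions.integrable_expH (hα : ∀ i, 0 < α i) (hH : Assumptions H θs) {n : ℝ}
    (hn : 0 ≤ n) : Integrable (expH H n) (dirichlet α) :=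
  integrable_dirichlet hα (aestronglyMeasurable_expH hH.continuousOn n α) _
    fun _ hθ _ => ⟨expH_nonneg H n _, hH.expH_le hn hθ⟩

theorem estimand_nonneg (α : Fin (d + 1) → ℝ) (H : (Fin (d + 1) → ℝ) → EReal) (n : ℝ) :
    0 ≤ estimand α H n :=
  integral_nonneg fun θ => expH_nonneg H n θ

theorem Assumptions.exists_estimand_le (hα : ∀ i, 0 < α i) (hH : Assumptions H θs) :
    ∃ C > 0, ∀ᶠ n : ℝ in atTop,
      estimand α H n ≤ C * n ^ (-decayExp α θs) * Real.exp (n * (H θs).toReal) := by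
  obtain ⟨C, hC, hle⟩ := exists_integral_exp_gap_le hα hH.mem_simplex
  obtain ⟨c, hc, hcle⟩ := hH.exists_expH_le
  refine ⟨C * c ^ (-decayExp α θs), by positivity, ?_⟩
  filter_upwards [eventually_ge_atTop 0, eventually_ge_atTop c⁻¹] with n hn0 hn
  have h1 : 1 ≤ n * c := by rwa [inv_le_iff_one_le_mul₀ hc] at hn
  have hI : Integrable (fun θ => Real.exp (n * (H θs).toReal) *
      Real.exp (-((n * c) * gap θs θ))) (dirichlet α) :=
    (integrable_exp_neg_gap hα θs (by positivity)).const_mul _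
  refine (integral_dirichlet_mono hI fun θ hθ _ => ⟨expH_nonneg H n θ, ?_⟩).trans ?_
  · rw [mul_assoc n]; exact hcle n hn0 θ hθ
  · rw [integral_const_mul]
    refine (mul_le_mul_of_nonneg_left (hle _ h1) (Real.exp_pos _).le).trans (le_of_eq ?_)
    rw [Real.mul_rpow hn0 hc.le]; ring

theorem Assumptions.exists_le_estimand (hα : ∀ i, 0 < α i) (hH : Assumptions H θs) :
    ∃ c > 0, ∀ᶠ n : ℝ in atTop,
      c * n ^ (-decayExp α θs) * Real.exp (n * (H θs).toReal) ≤ estimand α H n := by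
  obtain ⟨L, hL, δ, hδ, hLle⟩ := hH.exists_le_expH
  obtain ⟨c, hc, hle⟩ := exists_le_integral_exp_gap hα hH.mem_simplex hL.le hδ
  refine ⟨c, hc, ?_⟩
  filter_upwards [hle, eventually_ge_atTop 0] with n hn hn0
  rw [mul_comm]
  refine (mul_le_mul_of_nonneg_left hn (Real.exp_pos _).le).trans ?_
  rw [← integral_const_mul]
  refine integral_dirichlet_mono (hH.integrable_expH hα hn0) fun θ hθ _ =>
    ⟨mul_nonneg (Real.exp_pos _).le (Set.indicator_nonneg (fun _ _ => (Real.exp_pos _).le) _), ?_⟩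
  by_cases hV : ∀ i, |θ i - θs i| < δ
  · rw [Set.indicator_of_mem (by exact hV)]
    exact hLle n hn0 θ hθ hV
  · rw [Set.indicator_of_notMem (by exact hV), mul_zero]
    exact expH_nonneg H n θ

/-- The summand of the importance sampling estimator. -/
def isTerm (α : Fin (d + 1) → ℝ) (H : (Fin (d + 1) → ℝ) → EReal) (θs : Fin (d + 1) → ℝ)
    (γ ε n : ℝ) (θ : Fin (d + 1) → ℝ) : ℝ :=
  expH H n θ * (dirDensity α θ / dirDensity (proposalParam α θs γ n) θ) *
    (truncSimplex θs ε).indicator (fun _ => (1 : ℝ)) θ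

/-- The integrand of the second moment of `isTerm`, up to the factor `entropyLaplace`. -/
def tiltedTerm (H : (Fin (d + 1) → ℝ) → EReal) (θs : Fin (d + 1) → ℝ) (ε n t : ℝ)
    (θ : Fin (d + 1) → ℝ) : ℝ :=
  expH H n θ * Real.exp (t * relEntropy θs θ) *
    (truncSimplex θs ε).indicator (fun _ => (1 : ℝ)) θ

theorem entropyLaplace_nonneg (α θs : Fin (d + 1) → ℝ) (t : ℝ) : 0 ≤ entropyLaplace α θs t :=
  integral_nonneg fun _ => (Real.exp_pos _).le

theorem indicator_one_nonneg {X : Type*} (s : Set X) (x : X) :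
    0 ≤ s.indicator (fun _ => (1 : ℝ)) x :=
  Set.indicator_nonneg (fun _ _ => zero_le_one) x

theorem tiltedTerm_nonneg (H : (Fin (d + 1) → ℝ) → EReal) (θs : Fin (d + 1) → ℝ) (ε n t : ℝ)
    (θ : Fin (d + 1) → ℝ) : 0 ≤ tiltedTerm H θs ε n t θ :=
  mul_nonneg (mul_nonneg (expH_nonneg H n θ) (Real.exp_pos _).le) (indicator_one_nonneg _ θ)

theorem isTerm_eq (hα : ∀ i, 0 < α i) (hθs : ∀ i, 0 ≤ θs i) {γ ε n : ℝ} (hn : 0 ≤ n)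
    {θ : Fin (d + 1) → ℝ} (hpos : ∀ i, 0 < θ i) :
    isTerm α H θs γ ε n θ = entropyLaplace α θs (n ^ γ) * tiltedTerm H θs ε n (n ^ γ) θ := by
  have := dirDensity_div hα hθs (Real.rpow_nonneg hn γ) hpos
  unfold isTerm tiltedTerm proposalParam
  rw [this]; ring

theorem aestronglyMeasurable_tiltedTerm (hc : ContinuousOn H (stdSimplex ℝ (Fin (d + 1))))
    (ε n t : ℝ) (η : Fin (d + 1) → ℝ) :
    AEStronglyMeasurable (tiltedTerm H θs ε n t) (dirichlet η) := by
  have := measurable_relEntropy θs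
  exact ((aestronglyMeasurable_expH hc n η).mul
    (Measurable.aestronglyMeasurable (by fun_prop))).mul
    (measurable_const.indicator (isClosed_truncSimplex θs ε).measurableSet).aestronglyMeasurable

/-- Truncation keeps the relative entropy bounded. The constant depends on `n` and `t` and serves
only for integrability. -/
theorem Assumptions.exists_tiltedTerm_le (hH : Assumptions H θs) {ε n t : ℝ} (hε : 0 < ε)
    (hn : 0 ≤ n) (ht : 0 ≤ t) :
    ∃ C, ∀ θ ∈ stdSimplex ℝ (Fin (d + 1)), tiltedTerm H θs ε n t θ ≤ C := by
  refine ⟨Real.exp (n * (H θs).toReal) * Real.exp (t * ((1 + ε⁻¹) * (d + 1))), fun θ hθ => ?_⟩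
  unfold tiltedTerm
  by_cases h : θ ∈ truncSimplex θs ε
  · rw [Set.indicator_of_mem h, mul_one]
    refine mul_le_mul (hH.expH_le hn hθ) (Real.exp_le_exp.2 ?_) (Real.exp_pos _).le
      (Real.exp_pos _).le
    refine mul_le_mul_of_nonneg_left ((relEntropy_le hH.mem_simplex hε hθ h.2).trans ?_) ht
    exact mul_le_mul_of_nonneg_left (gap_le_card hH.mem_simplex hθ) (by positivity)
  · rw [Set.indicator_of_notMem h, mul_zero]; positivity

theorem Assumptions.memLp_isTerm (hα : ∀ i, 0 < α i) (hH : Assumptions H θs) {γ ε n : ℝ}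
    (hε : 0 < ε) (hn : 0 ≤ n) :
    MemLp (isTerm α H θs γ ε n) 2 (dirichlet (proposalParam α θs γ n)) := by
  have ht := Real.rpow_nonneg hn γ
  have hη : ∀ i, 0 < proposalParam α θs γ n i := param_add_pos hα hH.mem_simplex.1 ht
  have := isProbabilityMeasure_dirichlet hη
  obtain ⟨C, hC⟩ := hH.exists_tiltedTerm_le hε hn ht
  have hae : isTerm α H θs γ ε n =ᵐ[dirichlet (proposalParam α θs γ n)]
      fun θ => entropyLaplace α θs (n ^ γ) * tiltedTerm H θs ε n (n ^ γ) θ := by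
    filter_upwards [ae_dirichlet _] with θ hθ
    exact isTerm_eq hα hH.mem_simplex.1 hn hθ.2
  refine (memLp_congr_ae hae).2 (MemLp.const_mul (MemLp.of_bound
    (aestronglyMeasurable_tiltedTerm hH.continuousOn ε n (n ^ γ) _) C ?_) _)
  filter_upwards [ae_dirichlet (proposalParam α θs γ n)] with θ hθ
  rw [Real.norm_of_nonneg (tiltedTerm_nonneg _ _ _ _ _ _)]
  exact hC θ hθ.1

theorem integral_isTerm (hα : ∀ i, 0 < α i) (hθs : ∀ i, 0 ≤ θs i) {γ ε n : ℝ} (hn : 0 ≤ n) :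
    ∫ θ, isTerm α H θs γ ε n θ ∂dirichlet (proposalParam α θs γ n) =
      ∫ θ, expH H n θ * (truncSimplex θs ε).indicator (fun _ => (1 : ℝ)) θ ∂dirichlet α := by
  have hη : ∀ i, 0 < proposalParam α θs γ n i := param_add_pos hα hθs (Real.rpow_nonneg hn γ)
  refine integral_dirichlet_change hα hη fun θ _ hpos => ?_
  have := dirDensity_pos hη hpos
  unfold isTerm
  field_simp

/-- One of the two likelihood ratios is spent on returning to `Dir_α`; the other gives
`entropyLaplace` and the tilt. -/
theorem integral_isTerm_sq (hα : ∀ i, 0 < α i) (hθs : ∀ i, 0 ≤ θs i) {γ ε n : ℝ} (hn : 0 ≤ n) :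
    ∫ θ, isTerm α H θs γ ε n θ ^ 2 ∂dirichlet (proposalParam α θs γ n) =
      entropyLaplace α θs (n ^ γ) *
        ∫ θ, tiltedTerm H θs ε (2 * n) (n ^ γ) θ ∂dirichlet α := by
  have hη : ∀ i, 0 < proposalParam α θs γ n i := param_add_pos hα hθs (Real.rpow_nonneg hn γ)
  rw [← integral_const_mul]
  refine integral_dirichlet_change hα hη fun θ _ hpos => ?_
  have h1 := dirDensity_pos hη hpos
  have h2 := dirDensity_div hα hθs (Real.rpow_nonneg hn γ) hpos
  have h3 : (truncSimplex θs ε).indicator (fun _ => (1 : ℝ)) θ ^ 2 =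
      (truncSimplex θs ε).indicator (fun _ => (1 : ℝ)) θ := by
    by_cases h : θ ∈ truncSimplex θs ε <;> simp [h]
  change dirDensity α θ / dirDensity (proposalParam α θs γ n) θ = _ at h2
  have h4 : dirDensity (proposalParam α θs γ n) θ * (dirDensity α θ /
      dirDensity (proposalParam α θs γ n) θ) = dirDensity α θ := by field_simp
  unfold isTerm tiltedTerm
  rw [mul_pow, mul_pow, expH_sq, h3]
  set w := dirDensity α θ / dirDensity (proposalParam α θs γ n) θ
  rw [show ∀ D E I : ℝ, D * (E * w ^ 2 * I) = (D * w) * (w * (E * I)) by intros; ring, h4, h2]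
  ring

/-- Here `γ < 1` is used. The decay `exp(-2 n c gap)` of `expH H (2 * n)` is split in two: on the
truncated simplex the tilt is at most `exp(n^γ (1 + ε⁻¹) gap)`, which one half cancels for large
`n`, and the other half yields the order. -/
theorem Assumptions.exists_integral_tiltedTerm_le (hα : ∀ i, 0 < α i) (hH : Assumptions H θs)
    {γ ε : ℝ} (hε : 0 < ε) (hγ : γ < 1) :
    ∃ C > 0, ∀ᶠ n : ℝ in atTop, ∫ θ, tiltedTerm H θs ε (2 * n) (n ^ γ) θ ∂dirichlet α ≤
      C * n ^ (-decayExp α θs) * Real.exp (2 * n * (H θs).toReal) := by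
  obtain ⟨C, hC, hle⟩ := exists_integral_exp_gap_le hα hH.mem_simplex
  obtain ⟨c, hc, hcle⟩ := hH.exists_expH_le
  refine ⟨C * c ^ (-decayExp α θs), by positivity, ?_⟩
  have hL : 0 < 1 + ε⁻¹ := by positivity
  have htend : Tendsto (fun n : ℝ => n ^ (-(1 - γ))) atTop (𝓝 0) :=
    tendsto_rpow_neg_atTop (by linarith)
  filter_upwards [eventually_gt_atTop 0, eventually_ge_atTop c⁻¹,
    htend.eventually_lt_const (show 0 < c / (1 + ε⁻¹) by positivity)] with n hn0 hn hγn
  have h1 : 1 ≤ n * c := by rwa [inv_le_iff_one_le_mul₀ hc] at hn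
  have ht : n ^ γ * (1 + ε⁻¹) ≤ n * c := by
    rw [lt_div_iff₀ hL] at hγn
    have e : n ^ γ = n * n ^ (-(1 - γ)) := by
      nth_rewrite 2 [← Real.rpow_one n]
      rw [← Real.rpow_add hn0]
      congr 1; ring
    rw [e, mul_assoc]
    gcongr
  have hI : Integrable (fun θ => Real.exp (2 * n * (H θs).toReal) *
      Real.exp (-((n * c) * gap θs θ))) (dirichlet α) :=
    (integrable_exp_neg_gap hα θs (by positivity)).const_mul _
  refine (integral_dirichlet_mono hI fun θ hθ hpos =>
    ⟨tiltedTerm_nonneg _ _ _ _ _ _, ?_⟩).trans ?_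
  · unfold tiltedTerm
    by_cases h : θ ∈ truncSimplex θs ε
    · rw [Set.indicator_of_mem h, mul_one]
      refine (mul_le_mul_of_nonneg_right (hcle (2 * n) (by positivity) θ hθ)
        (Real.exp_pos _).le).trans ?_
      rw [mul_assoc, ← Real.exp_add]
      refine mul_le_mul_of_nonneg_left (Real.exp_le_exp.2 ?_) (Real.exp_pos _).le
      have h2 := mul_le_mul_of_nonneg_left (relEntropy_le hH.mem_simplex hε hθ h.2)
        (Real.rpow_nonneg hn0.le γ)
      have h3 := mul_le_mul_of_nonneg_right ht (gap_nonneg (θs := θs) hθ.1)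
      linarith
    · rw [Set.indicator_of_notMem h, mul_zero]; positivity
  · rw [integral_const_mul]
    refine (mul_le_mul_of_nonneg_left (hle _ h1) (Real.exp_pos _).le).trans (le_of_eq ?_)
    rw [Real.mul_rpow hn0.le hc.le]; ring

/-- The tilt is at least `1` because relative entropy is nonnegative, and a small neighborhood of
`θs` in the simplex lies in the truncated simplex because `ε < θs i` on the support. -/
theorem Assumptions.exists_le_integral_tiltedTerm (hα : ∀ i, 0 < α i) (hH : Assumptions H θs)
    {γ ε : ℝ} (hε0 : 0 < ε) (hε : ∀ i, 0 < θs i → ε < θs i) :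
    ∃ c > 0, ∀ᶠ n : ℝ in atTop, c * n ^ (-decayExp α θs) * Real.exp (2 * n * (H θs).toReal) ≤
      ∫ θ, tiltedTerm H θs ε (2 * n) (n ^ γ) θ ∂dirichlet α := by
  obtain ⟨L, hL, δ, hδ, hLle⟩ := hH.exists_le_expH
  obtain ⟨b, hb, hbl⟩ := exists_pos_forall_le (Finset.univ.filter fun i => 0 < θs i)
    (fun i => θs i - ε) fun i hi => sub_pos.2 (hε i (by simpa using hi))
  obtain ⟨c, hc, hle⟩ := exists_le_integral_exp_gap hα hH.mem_simplex
    (L := 2 * L) (δ := min δ b) (by positivity) (by positivity)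
  refine ⟨c, hc, ?_⟩
  filter_upwards [hle, eventually_ge_atTop 0] with n hn hn0
  have ht := Real.rpow_nonneg hn0 γ
  rw [mul_comm]
  refine (mul_le_mul_of_nonneg_left hn (Real.exp_pos _).le).trans ?_
  rw [← integral_const_mul]
  obtain ⟨C, hC⟩ := hH.exists_tiltedTerm_le (n := 2 * n) hε0 (by positivity) ht
  refine integral_dirichlet_mono (integrable_dirichlet hα
    (aestronglyMeasurable_tiltedTerm hH.continuousOn _ _ _ _) C
      fun θ hθ _ => ⟨tiltedTerm_nonneg _ _ _ _ _ _, hC θ hθ⟩) fun θ hθ hpos =>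
    ⟨mul_nonneg (Real.exp_pos _).le (Set.indicator_nonneg (fun _ _ => (Real.exp_pos _).le) _), ?_⟩
  by_cases hV : ∀ i, |θ i - θs i| < min δ b
  · have htr : θ ∈ truncSimplex θs ε := ⟨hθ, fun i hi => by
      have h1 := hbl i (by simpa using hi)
      have h2 := (abs_lt.1 ((hV i).trans_le (min_le_right _ _))).1
      linarith⟩
    rw [Set.indicator_of_mem (by exact hV), tiltedTerm, Set.indicator_of_mem htr, mul_one]
    have h1 := hLle (2 * n) (by positivity) θ hθ fun i => (hV i).trans_le (min_le_left _ _)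
    have h2 : 1 ≤ Real.exp (n ^ γ * relEntropy θs θ) :=
      Real.one_le_exp (mul_nonneg ht (relEntropy_nonneg hH.mem_simplex hθ hpos))
    have h3 : -(n * (2 * L * gap θs θ)) = -(2 * n * (L * gap θs θ)) := by ring
    rw [h3]
    exact h1.trans (le_mul_of_one_le_right (expH_nonneg _ _ _) h2)
  · rw [Set.indicator_of_notMem (by exact hV), mul_zero]
    exact tiltedTerm_nonneg _ _ _ _ _ _

end

/-! ### Orders of the two mean squared errors -/

section

variable {d : ℕ} {α θs : Fin (d + 1) → ℝ} {H : (Fin (d + 1) → ℝ) → EReal}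

theorem card_zeroSet_le (hθs : θs ∈ stdSimplex ℝ (Fin (d + 1))) : (zeroSet θs).card ≤ d := by
  by_contra! h
  have h1 : (zeroSet θs).card ≤ d + 1 := by
    simpa using Finset.card_le_univ (zeroSet θs)
  have h2 : zeroSet θs = Finset.univ :=
    Finset.eq_univ_of_card _ (by simp; omega)
  have h3 : ∀ i, θs i = 0 := fun i => by
    have : i ∈ zeroSet θs := h2 ▸ Finset.mem_univ i
    simpa [zeroSet] using this
  have := hθs.2
  simp [h3] at this

theorem decayExp_eq (α θs : Fin (d + 1) → ℝ) :
    decayExp α θs = ((d : ℝ) - (zeroSet θs).card) / 2 + ∑ i ∈ zeroSet θs, α i := by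
  have h1 : ∀ i, localExp (α i) (θs i) = 1 / 2 + if θs i = 0 then α i - 1 / 2 else 0 := by
    intro i; unfold localExp; split_ifs <;> ring
  simp_rw [decayExp, h1]
  rw [Finset.sum_add_distrib, ← Finset.sum_filter, ← zeroSet, Finset.sum_sub_distrib]
  simp
  ring

/-- Positivity is what makes squared means negligible against second moments. When `θs` is interior
it rests on `1 ≤ d`; otherwise on `α i > 0`. -/
theorem decayExp_pos (hd : 1 ≤ d) (hα : ∀ i, 0 < α i)
    (hθs : θs ∈ stdSimplex ℝ (Fin (d + 1))) : 0 < decayExp α θs := by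
  rw [decayExp_eq]
  have h1 : ((zeroSet θs).card : ℝ) ≤ d := Nat.cast_le.2 (card_zeroSet_le hθs)
  rcases (zeroSet θs).eq_empty_or_nonempty with h | h
  · have : (1 : ℝ) ≤ d := by exact_mod_cast hd
    rw [h]; simp; linarith
  · have := Finset.sum_pos (fun i _ => hα i) h
    linarith

theorem isTheta_of_bounds {l : Filter ℝ} {f g : ℝ → ℝ} {c C : ℝ} (hc : 0 < c)
    (hg : ∀ᶠ n in l, 0 ≤ g n) (hlo : ∀ᶠ n in l, c * g n ≤ f n)
    (hup : ∀ᶠ n in l, f n ≤ C * g n) : f =Θ[l] g := by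
  refine ⟨IsBigO.of_bound C ?_, IsBigO.of_bound c⁻¹ ?_⟩
  · filter_upwards [hg, hlo, hup] with n h1 h2 h3
    rw [Real.norm_of_nonneg h1, Real.norm_of_nonneg ((mul_nonneg hc.le h1).trans h2)]
    exact h3
  · filter_upwards [hg, hlo] with n h1 h2
    rw [Real.norm_of_nonneg h1, Real.norm_of_nonneg ((mul_nonneg hc.le h1).trans h2)]
    rwa [le_inv_mul_iff₀ hc]

theorem rpow_mul_exp_sq {n : ℝ} (hn : 0 ≤ n) (C κ h : ℝ) :
    (C * n ^ (-κ) * Real.exp (n * h)) ^ 2 =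
      C ^ 2 * n ^ (-(2 * κ)) * Real.exp (2 * n * h) := by
  have h1 : -(2 * κ) = -κ * (2 : ℕ) := by push_cast; ring
  have h2 : 2 * n * h = (2 : ℕ) * (n * h) := by push_cast; ring
  rw [mul_pow, mul_pow, h1, h2, Real.rpow_mul_natCast hn, Real.exp_nat_mul]

theorem eventually_mul_rpow_neg_le (A : ℝ) {b x y : ℝ} (hb : 0 < b) (hxy : x < y) :
    ∀ᶠ n : ℝ in atTop, A * n ^ (-y) ≤ b * n ^ (-x) := by
  have htend : Tendsto (fun n : ℝ => A * n ^ (-(y - x))) atTop (𝓝 (A * 0)) :=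
    (tendsto_rpow_neg_atTop (by linarith)).const_mul A
  rw [mul_zero] at htend
  filter_upwards [htend.eventually_lt_const hb, eventually_gt_atTop 0] with n hn hn0
  have : n ^ (-y) = n ^ (-(y - x)) * n ^ (-x) := by
    rw [← Real.rpow_add hn0]; congr 1; ring
  rw [this, ← mul_assoc]
  gcongr

/-- The squared estimand decays with exponent `2 * decayExp`; the result serves with `x = κ` for
Monte Carlo and `x = γ κ + κ` for importance sampling. -/
theorem Assumptions.eventually_estimand_sq_le (hα : ∀ i, 0 < α i) (hH : Assumptions H θs) {x b : ℝ}
    (hx : x < 2 * decayExp α θs) (hb : 0 < b) : ∀ᶠ n : ℝ in atTop,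
      estimand α H n ^ 2 ≤ b * n ^ (-x) * Real.exp (2 * n * (H θs).toReal) := by
  obtain ⟨C, hC, hle⟩ := hH.exists_estimand_le hα
  filter_upwards [hle, eventually_ge_atTop 0, eventually_mul_rpow_neg_le (C ^ 2) hb hx]
    with n hn hn0 h
  refine (pow_le_pow_left₀ (estimand_nonneg α H n) hn 2).trans ?_
  rw [rpow_mul_exp_sq hn0]
  gcongr

/-- The estimator is unbiased and its summand squares to `expH H (2 * n)`, so the second moment is
the estimand at `2 * n`. -/
theorem Assumptions.mseMC_isTheta (hd : 1 ≤ d) (hα : ∀ i, 0 < α i) (hH : Assumptions H θs)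
    {N : ℕ} (hN : 1 ≤ N) :
    (fun n : ℝ => mseMC N α H n) =Θ[atTop]
      fun n => n ^ (-decayExp α θs) * Real.exp (2 * n * (H θs).toReal) := by
  have hN0 : (0 : ℝ) < N := by positivity
  have hκ := decayExp_pos hd hα hH.mem_simplex
  have := isProbabilityMeasure_dirichlet hα
  have hmse : ∀ n ≥ 0, mseMC N α H n = (1 / N) * (estimand α H (2 * n) - estimand α H n ^ 2) := by
    intro n hn
    have hL : MemLp (expH H n) 2 (dirichlet α) := by
      refine MemLp.of_bound (aestronglyMeasurable_expH hH.continuousOn n α)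
        (Real.exp (n * (H θs).toReal)) ?_
      filter_upwards [ae_dirichlet α] with θ hθ
      rw [Real.norm_of_nonneg (expH_nonneg H n θ)]
      exact hH.expH_le hn hθ.1
    have := mse_sampleMean hN (dirichlet α) hL (estimand α H n)
    simp_rw [expH_sq] at this
    rw [mseMC]
    refine this.trans ?_
    simp [estimand]
  obtain ⟨c, hc, hlo⟩ := hH.exists_le_estimand hα
  obtain ⟨C, hC, hup⟩ := hH.exists_estimand_le hα
  have h2 : Tendsto (fun n : ℝ => 2 * n) atTop atTop := tendsto_id.const_mul_atTop two_pos
  set c' := c * 2 ^ (-decayExp α θs)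
  have hc' : 0 < c' := by positivity
  refine isTheta_of_bounds (c := 1 / N * (c' / 2)) (C := 1 / N * (C * 2 ^ (-decayExp α θs)))
    (by positivity) ?_ ?_ ?_
  · filter_upwards [eventually_ge_atTop 0] with n hn
    positivity
  · filter_upwards [eventually_ge_atTop 0, h2.eventually hlo,
      hH.eventually_estimand_sq_le hα (show decayExp α θs < 2 * decayExp α θs by linarith)
        (half_pos hc')] with n hn h3 h4
    rw [hmse n hn, mul_assoc]
    rw [Real.mul_rpow two_pos.le hn, ← mul_assoc] at h3
    change c' * _ * _ ≤ _ at h3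
    refine mul_le_mul_of_nonneg_left ?_ (by positivity)
    linarith
  · filter_upwards [eventually_ge_atTop 0, h2.eventually hup] with n hn h3
    rw [hmse n hn, mul_assoc]
    rw [Real.mul_rpow two_pos.le hn, ← mul_assoc] at h3
    refine mul_le_mul_of_nonneg_left ?_ (by positivity)
    linarith [sq_nonneg (estimand α H n)]

/-- The second moment `S n` decides the order. The truncated mean satisfies `0 ≤ I n ≤ estimand α H
n`, so both its square and the squared bias are at most the squared estimand; no finer estimate of
the truncation bias is needed. -/
theorem Assumptions.mseIS_isTheta (hd : 1 ≤ d) (hα : ∀ i, 0 < α i) (hH : Assumptions H θs)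
    {γ ε : ℝ} (hγ0 : 0 < γ) (hγ1 : γ < 1) (hε0 : 0 < ε) (hε : ∀ i, 0 < θs i → ε < θs i)
    {N : ℕ} (hN : 1 ≤ N) :
    (fun n : ℝ => mseIS N α H θs γ ε n) =Θ[atTop]
      fun n => n ^ (-(γ * decayExp α θs + decayExp α θs)) *
        Real.exp (2 * n * (H θs).toReal) := by
  have hN0 : (0 : ℝ) < N := by positivity
  have hκ := decayExp_pos hd hα hH.mem_simplex
  set κ := decayExp α θs
  set S : ℝ → ℝ := fun n => entropyLaplace α θs (n ^ γ) *
    ∫ θ, tiltedTerm H θs ε (2 * n) (n ^ γ) θ ∂dirichlet α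
  set I : ℝ → ℝ := fun n => ∫ θ, expH H n θ *
    (truncSimplex θs ε).indicator (fun _ => (1 : ℝ)) θ ∂dirichlet α
  have hmse : ∀ n ≥ 0, mseIS N α H θs γ ε n =
      (1 / N) * (S n - I n ^ 2) + (I n - estimand α H n) ^ 2 := by
    intro n hn
    have := isProbabilityMeasure_dirichlet (α := proposalParam α θs γ n)
      (param_add_pos hα hH.mem_simplex.1 (Real.rpow_nonneg hn γ))
    have h := mse_sampleMean hN (dirichlet (proposalParam α θs γ n))
      (hH.memLp_isTerm hα (γ := γ) hε0 hn) (estimand α H n)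
    rw [integral_isTerm hα hH.mem_simplex.1 hn, integral_isTerm_sq hα hH.mem_simplex.1 hn] at h
    exact h
  have hI0 : ∀ n, 0 ≤ I n := fun n => integral_nonneg fun θ =>
    mul_nonneg (expH_nonneg H n θ) (indicator_one_nonneg _ θ)
  have hI1 : ∀ n ≥ 0, I n ≤ estimand α H n := fun n hn =>
    integral_dirichlet_mono (hH.integrable_expH hα hn) fun θ _ _ =>
      ⟨mul_nonneg (expH_nonneg H n θ) (indicator_one_nonneg _ θ),
        mul_le_of_le_one_right (expH_nonneg H n θ)
          (Set.indicator_le_self' (fun _ _ => zero_le_one) θ)⟩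
  obtain ⟨c₁, hc₁, hlo₁⟩ := exists_le_entropyLaplace hα hH.mem_simplex
  obtain ⟨C₁, hC₁, hup₁⟩ := exists_entropyLaplace_le hα hH.mem_simplex
  obtain ⟨c₂, hc₂, hlo₂⟩ := hH.exists_le_integral_tiltedTerm hα (γ := γ) hε0 hε
  obtain ⟨C₂, hC₂, hup₂⟩ := hH.exists_integral_tiltedTerm_le hα hε0 hγ1
  have ht := tendsto_rpow_atTop hγ0
  -- The condition `γ < 1` again: the second moment must dominate the squared estimand.
  have hexp : γ * κ + κ < 2 * κ := by nlinarith
  have hprod : ∀ n > 0, ∀ a b : ℝ, (a * (n ^ γ) ^ (-κ)) *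
      (b * n ^ (-κ) * Real.exp (2 * n * (H θs).toReal)) =
      a * b * n ^ (-(γ * κ + κ)) * Real.exp (2 * n * (H θs).toReal) := by
    intro n hn a b
    have : n ^ (-(γ * κ + κ)) = (n ^ γ) ^ (-κ) * n ^ (-κ) := by
      rw [← Real.rpow_mul hn.le, ← Real.rpow_add hn]; congr 1; ring
    rw [this]; ring
  -- Half of the lower bound for `S n` is given up to the squared mean; the `+ 1` above pays for the
  -- squared bias.
  refine isTheta_of_bounds (c := 1 / N * (c₁ * c₂ / 2)) (C := 1 / N * (C₁ * C₂) + 1)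
    (by positivity) ?_ ?_ ?_
  · filter_upwards [eventually_ge_atTop 0] with n hn
    positivity
  · filter_upwards [eventually_gt_atTop 0, ht.eventually hlo₁, hlo₂,
      hH.eventually_estimand_sq_le hα hexp (show 0 < c₁ * c₂ / 2 by positivity)] with n hn h1 h2 h3
    rw [hmse n hn.le]
    have h4 : c₁ * c₂ * n ^ (-(γ * κ + κ)) * Real.exp (2 * n * (H θs).toReal) ≤ S n := by
      rw [← hprod n hn]
      exact mul_le_mul h1 h2 (by positivity) (entropyLaplace_nonneg _ _ _)
    have h5 := pow_le_pow_left₀ (hI0 n) (hI1 n hn.le) 2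
    refine le_add_of_le_of_nonneg ?_ (sq_nonneg _)
    rw [mul_assoc]
    refine mul_le_mul_of_nonneg_left ?_ (by positivity)
    linarith
  · filter_upwards [eventually_gt_atTop 0, ht.eventually hup₁, hup₂,
      hH.eventually_estimand_sq_le hα hexp one_pos] with n hn h1 h2 h3
    rw [hmse n hn.le]
    have h4 : S n ≤ C₁ * C₂ * n ^ (-(γ * κ + κ)) * Real.exp (2 * n * (H θs).toReal) := by
      rw [← hprod n hn]
      exact mul_le_mul h1 h2 (integral_nonneg fun θ => tiltedTerm_nonneg _ _ _ _ _ _)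
        (by positivity)
    have h5 : (I n - estimand α H n) ^ 2 ≤ estimand α H n ^ 2 := by
      have := hI0 n
      have := hI1 n hn.le
      nlinarith
    have h6 : 1 / (N : ℝ) * (S n - I n ^ 2) ≤ 1 / N * (C₁ * C₂ * n ^ (-(γ * κ + κ)) *
        Real.exp (2 * n * (H θs).toReal)) := by
      refine mul_le_mul_of_nonneg_left ?_ (by positivity)
      linarith [sq_nonneg (I n)]
    linarith

end

end DirichletIS

end

theorem theorem3 (d : ℕ) (hd : 1 ≤ d) (α : Fin (d + 1) → ℝ) (hα : ∀ i, 0 < α i)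
    (H : (Fin (d + 1) → ℝ) → EReal) (θs : Fin (d + 1) → ℝ)
    (hH : DirichletIS.Assumptions H θs)
    (γ : ℝ) (hγ0 : 0 < γ) (hγ1 : γ < 1)
    (ε : ℝ) (hε0 : 0 < ε) (hε : ∀ i, 0 < θs i → ε < θs i)
    (N : ℕ) (hN : 1 ≤ N) :
    (fun n : ℝ => DirichletIS.mseIS N α H θs γ ε n / DirichletIS.mseMC N α H n)
      =Θ[atTop]
    (fun n : ℝ =>
      n ^ (-γ * (((d : ℝ) - ((DirichletIS.zeroSet θs).card : ℝ)) / 2)) *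
        n ^ (-γ * ∑ i ∈ DirichletIS.zeroSet θs, α i)) := by
  refine ((hH.mseIS_isTheta hd hα hγ0 hγ1 hε0 hε hN).div
    (hH.mseMC_isTheta hd hα hN)).trans_eventuallyEq ?_
  filter_upwards [eventually_gt_atTop 0] with n hn
  rw [mul_div_mul_right _ _ (Real.exp_pos _).ne', ← Real.rpow_sub hn, ← Real.rpow_add hn,
    DirichletIS.decayExp_eq]
  congr 1
  ring
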